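/- Let $(M,g,J)$ be a connected smooth almost Hermitian manifold (that is, $g$ is a smooth Riemannian metric and $J$ a smooth field of endomorphisms of the tangent spaces with $J^2=-1$ and $g(Jx,Jy)=g(x,y)$) of real dimension $2m\ge 6$. Let $\nabla$ be the Levi-Civita connection of $g$, let $R(x,y,z,u)=g(\nabla_x\nabla_y z-\nabla_y\nabla_x z-\nabla_{[x,y]}z,\,u)$, and for a 2-plane $\alpha\subset T_pM$ with orthonormal basis $\{x,y\}$ let $K(\alpha)=R(x,y,y,x)$ be its sectional curvature. For $\theta\in[0,\pi/2]$ the 2-plane $\alpha$ is called $\theta$-holomorphic if the angle between $\alpha$ and $J\alpha$ is $\theta$, i.e. if $|g(x,Jy)|=\cos\theta$. One says that $M$ has pointwise constant $\theta$-holomorphic sectional curvature if there is a function $c:M\to\mathbb R$ with $K(\alpha)=c(p)$ for every $p\in M$ and every $\theta$-holomorphic 2-plane $\alpha\subset T_pM$, and constant $\theta$-holomorphic sectional curvature if moreover $c$ can be taken constant on $M$. $M$ is called Kähler if $\nabla J=0$. Let $\theta\in(0,\pi/2)$ and suppose that $M$ has pointwise constant $\theta$-holomorphic sectional curvature. Then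 either $M$ has constant sectional curvature (there is $c\in\mathbb R$ with $K(\alpha)=c$ for all $p\in M$ and all 2-planes $\alpha\subset T_pM$), or $M$ is Kähler and has constant $\varphi$-holomorphic sectional curvature for every $\varphi\in(0,\pi/2)$. (The "or" is not exclusive.) -/

import Mathlib

open Bundle FiberBundle VectorField
open scoped Manifold ContDiff Topology

noncomputable section

namespace AlmostHermitian

set_option linter.unusedSectionVars false

section LeviCivita

variable {E : Type*} [NormedAddCommGroup E] [NormedSpace ℝ E] [FiniteDimensional ℝ E]
  {M : Type*} [TopologicalSpace M] [ChartedSpace E M] [IsManifold 𝓘(ℝ, E) ∞ M]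
  [RiemannianBundle (fun x : M ↦ TangentSpace 𝓘(ℝ, E) x)]

instance tangentFinite (x : M) : FiniteDimensional ℝ (TangentSpace 𝓘(ℝ, E) x) :=
  inferInstanceAs (FiniteDimensional ℝ E)
/-- The right-hand side of the Koszul formula for `⟨∇_X Y, Z⟩` at the point `p`. -/
def koszul (X Y Z : Π x : M, TangentSpace 𝓘(ℝ, E) x) (p : M) : ℝ :=
  (1 / 2 : ℝ) *
    (d% (fun q ↦ inner ℝ (Y q) (Z q)) p (X p) + d% (fun q ↦ inner ℝ (X q) (Z q)) p (Y p)
      - d% (fun q ↦ inner ℝ (X q) (Y q)) p (Z p)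
      + inner ℝ (mlieBracket 𝓘(ℝ, E) X Y p) (Z p)
      - inner ℝ (mlieBracket 𝓘(ℝ, E) X Z p) (Y p)
      - inner ℝ (mlieBracket 𝓘(ℝ, E) Y Z p) (X p))

variable [IsContMDiffRiemannianBundle 𝓘(ℝ, E) ∞ E (fun x : M ↦ TangentSpace 𝓘(ℝ, E) x)]

theorem mdiffAt_inner {X Y : Π x : M, TangentSpace 𝓘(ℝ, E) x} {p : M}
    (hX : MDiffAt (T% X) p) (hY : MDiffAt (T% Y) p) :
    MDiffAt (fun q ↦ inner ℝ (X q) (Y q)) p :=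
  MDifferentiableAt.inner_bundle (F := E) (E := fun x : M ↦ TangentSpace 𝓘(ℝ, E) x)
    (b := fun q ↦ q) hX hY

theorem koszul_tensorial_right (Y X : Π x : M, TangentSpace 𝓘(ℝ, E) x) {p : M}
    (hX : MDiffAt (T% X) p) (hY : MDiffAt (T% Y) p) :
    TensorialAt 𝓘(ℝ, E) E (fun Z ↦ koszul X Y Z p) p where
  smul {f Z} hf hZ := by
    have e1 : (fun q ↦ inner ℝ (Y q) ((f • Z) q)) = fun q ↦ f q * inner ℝ (Y q) (Z q) := by
      ext q; simp [inner_smul_right]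
    have e2 : (fun q ↦ inner ℝ (X q) ((f • Z) q)) = fun q ↦ f q * inner ℝ (X q) (Z q) := by
      ext q; simp [inner_smul_right]
    simp only [koszul, e1, e2, mvfderiv_fun_mul hf (mdiffAt_inner hY hZ),
      mvfderiv_fun_mul hf (mdiffAt_inner hX hZ), mlieBracket_smul_right hf hZ]
    simp [inner_add_left, inner_smul_left, inner_smul_right]
    rw [real_inner_comm (Y p) (Z p), real_inner_comm (X p) (Z p)]
    ring
  add {Z Z'} hZ hZ' := by
    have e1 : (fun q ↦ inner ℝ (Y q) ((Z + Z') q))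
        = fun q ↦ inner ℝ (Y q) (Z q) + inner ℝ (Y q) (Z' q) := by
      ext q; simp [inner_add_right]
    have e2 : (fun q ↦ inner ℝ (X q) ((Z + Z') q))
        = fun q ↦ inner ℝ (X q) (Z q) + inner ℝ (X q) (Z' q) := by
      ext q; simp [inner_add_right]
    simp only [koszul, e1, e2, mvfderiv_fun_add (mdiffAt_inner hY hZ) (mdiffAt_inner hY hZ'),
      mvfderiv_fun_add (mdiffAt_inner hX hZ) (mdiffAt_inner hX hZ'), mlieBracket_add_right hZ hZ']
    simp [inner_add_left, inner_add_right]
    ring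

theorem koszul_tensorial_left (Y Z : Π x : M, TangentSpace 𝓘(ℝ, E) x) {p : M}
    (hY : MDiffAt (T% Y) p) (hZ : MDiffAt (T% Z) p) :
    TensorialAt 𝓘(ℝ, E) E (fun X ↦ koszul X Y Z p) p where
  smul {f X} hf hX := by
    have e1 : (fun q ↦ inner ℝ ((f • X) q) (Z q)) = fun q ↦ f q * inner ℝ (X q) (Z q) := by
      ext q; simp [inner_smul_left]
    have e2 : (fun q ↦ inner ℝ ((f • X) q) (Y q)) = fun q ↦ f q * inner ℝ (X q) (Y q) := by
      ext q; simp [inner_smul_left]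
    simp only [koszul, e1, e2, mvfderiv_fun_mul hf (mdiffAt_inner hX hZ),
      mvfderiv_fun_mul hf (mdiffAt_inner hX hY), mlieBracket_smul_left hf hX]
    simp [inner_add_left, inner_smul_left, inner_smul_right]
    ring
  add {X X'} hX hX' := by
    have e1 : (fun q ↦ inner ℝ ((X + X') q) (Z q))
        = fun q ↦ inner ℝ (X q) (Z q) + inner ℝ (X' q) (Z q) := by
      ext q; simp [inner_add_left]
    have e2 : (fun q ↦ inner ℝ ((X + X') q) (Y q))
        = fun q ↦ inner ℝ (X q) (Y q) + inner ℝ (X' q) (Y q) := by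
      ext q; simp [inner_add_left]
    simp only [koszul, e1, e2, mvfderiv_fun_add (mdiffAt_inner hX hZ) (mdiffAt_inner hX' hZ),
      mvfderiv_fun_add (mdiffAt_inner hX hY) (mdiffAt_inner hX' hY), mlieBracket_add_left hX hX']
    simp [inner_add_left, inner_add_right]
    ring


theorem koszul_add_middle {X Y Y' Z : Π x : M, TangentSpace 𝓘(ℝ, E) x} {p : M}
    (hX : MDiffAt (T% X) p) (hY : MDiffAt (T% Y) p) (hY' : MDiffAt (T% Y') p)
    (hZ : MDiffAt (T% Z) p) :
    koszul X (Y + Y') Z p = koszul X Y Z p + koszul X Y' Z p := by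
  have e1 : (fun q ↦ inner ℝ ((Y + Y') q) (Z q))
      = fun q ↦ inner ℝ (Y q) (Z q) + inner ℝ (Y' q) (Z q) := by
    ext q; simp [inner_add_left]
  have e2 : (fun q ↦ inner ℝ (X q) ((Y + Y') q))
      = fun q ↦ inner ℝ (X q) (Y q) + inner ℝ (X q) (Y' q) := by
    ext q; simp [inner_add_right]
  simp only [koszul, e1, e2, mvfderiv_fun_add (mdiffAt_inner hY hZ) (mdiffAt_inner hY' hZ),
    mvfderiv_fun_add (mdiffAt_inner hX hY) (mdiffAt_inner hX hY'),
    mlieBracket_add_left hY hY', mlieBracket_add_right hY hY']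
  simp [inner_add_left, inner_add_right]
  ring

theorem koszul_smul_middle {X Y Z : Π x : M, TangentSpace 𝓘(ℝ, E) x} {f : M → ℝ} {p : M}
    (hf : MDiffAt f p) (hX : MDiffAt (T% X) p) (hY : MDiffAt (T% Y) p) (hZ : MDiffAt (T% Z) p) :
    koszul X (f • Y) Z p = f p * koszul X Y Z p + d% f p (X p) * inner ℝ (Y p) (Z p) := by
  have e1 : (fun q ↦ inner ℝ ((f • Y) q) (Z q)) = fun q ↦ f q * inner ℝ (Y q) (Z q) := by
    ext q; simp [inner_smul_left]
  have e2 : (fun q ↦ inner ℝ (X q) ((f • Y) q)) = fun q ↦ f q * inner ℝ (X q) (Y q) := by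
    ext q; simp [inner_smul_right]
  simp only [koszul, e1, e2, mvfderiv_fun_mul hf (mdiffAt_inner hY hZ),
    mvfderiv_fun_mul hf (mdiffAt_inner hX hY), mlieBracket_smul_left hf hY,
    mlieBracket_smul_right hf hY]
  simp [inner_add_left, inner_smul_left, inner_smul_right]
  rw [real_inner_comm (X p) (Y p)]
  ring

/-- The bilinear form `(x, z) ↦ ⟨∇_x Y, z⟩` on `T_p M` given by the Koszul formula. -/
def koszulForm (Y : Π x : M, TangentSpace 𝓘(ℝ, E) x) (p : M) (hY : MDiffAt (T% Y) p) :
    TangentSpace 𝓘(ℝ, E) p →L[ℝ] TangentSpace 𝓘(ℝ, E) p →L[ℝ] ℝ :=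
  TensorialAt.mkHom₂ (fun X Z ↦ koszul X Y Z p) p
    (fun Z hZ ↦ koszul_tensorial_left Y Z hY hZ) (fun X hX ↦ koszul_tensorial_right Y X hX hY)

open Classical in
/-- `leviCivitaFun Y p x = ∇_x Y`, the vector dual to the Koszul form; the junk value `0` is used
where the vector field `Y` is not differentiable. -/
def leviCivitaFun (Y : Π x : M, TangentSpace 𝓘(ℝ, E) x) (p : M) :
    TangentSpace 𝓘(ℝ, E) p →L[ℝ] TangentSpace 𝓘(ℝ, E) p :=
  if hY : MDiffAt (T% Y) p then
    ∑ i, ((koszulForm Y p hY).flip (stdOrthonormalBasis ℝ (TangentSpace 𝓘(ℝ, E) p) i)).smulRight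
      (stdOrthonormalBasis ℝ (TangentSpace 𝓘(ℝ, E) p) i)
  else 0

theorem inner_leviCivitaFun {X Y Z : Π x : M, TangentSpace 𝓘(ℝ, E) x} {p : M}
    (hX : MDiffAt (T% X) p) (hY : MDiffAt (T% Y) p) (hZ : MDiffAt (T% Z) p) :
    inner ℝ (leviCivitaFun Y p (X p)) (Z p) = koszul X Y Z p := by
  have h : koszulForm Y p hY (X p) (Z p) = koszul X Y Z p := TensorialAt.mkHom₂_apply _ _ hX hZ
  rw [← h]
  have hz := (stdOrthonormalBasis ℝ (TangentSpace 𝓘(ℝ, E) p)).sum_repr' (Z p)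
  conv_rhs => rw [← hz]
  simp only [leviCivitaFun, dif_pos hY, map_sum, sum_apply, sum_inner,
    ContinuousLinearMap.smulRight_apply, ContinuousLinearMap.flip_apply, map_smul, inner_smul_left,
    smul_eq_mul]
  exact Finset.sum_congr rfl fun i _ ↦ by simp [mul_comm]

theorem mdiffAt_extend {p : M} (v : TangentSpace 𝓘(ℝ, E) p) :
    MDiffAt (T% (extend E v : Π x : M, TangentSpace 𝓘(ℝ, E) x)) p :=
  mdifferentiableAt_extend ..

theorem inner_leviCivitaFun_extend {Y : Π x : M, TangentSpace 𝓘(ℝ, E) x} {p : M}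
    (hY : MDiffAt (T% Y) p) (x z : TangentSpace 𝓘(ℝ, E) p) :
    inner ℝ (leviCivitaFun Y p x) z = koszul (extend E x) Y (extend E z) p := by
  rw [← inner_leviCivitaFun (mdiffAt_extend x) hY (mdiffAt_extend z)]
  simp

variable (E M) in
/-- The Levi-Civita connection of the Riemannian manifold `M`. -/
def leviCivita : CovariantDerivative 𝓘(ℝ, E) E (fun x : M ↦ TangentSpace 𝓘(ℝ, E) x) where
  toFun := leviCivitaFun
  isCovariantDerivativeOnUniv :=
    { add := fun {Y Y' p} hY hY' _ ↦ by
        ext1 x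
        refine ext_inner_right ℝ fun z ↦ ?_
        have h := mdifferentiableAt_add_section hY hY'
        rw [add_apply, inner_add_left, inner_leviCivitaFun_extend h,
          inner_leviCivitaFun_extend hY, inner_leviCivitaFun_extend hY',
          koszul_add_middle (mdiffAt_extend x) hY hY' (mdiffAt_extend z)]
      leibniz := fun {Y f p} hY hf _ ↦ by
        ext1 x
        refine ext_inner_right ℝ fun z ↦ ?_
        have h := hf.smul_section hY
        rw [add_apply, inner_add_left, inner_leviCivitaFun_extend h,
          koszul_smul_middle hf (mdiffAt_extend x) hY (mdiffAt_extend z),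
          smul_apply, inner_smul_left, inner_leviCivitaFun_extend hY,
          ContinuousLinearMap.smulRight_apply, inner_smul_left]
        simp }

theorem inner_leviCivita {X Y Z : Π x : M, TangentSpace 𝓘(ℝ, E) x} {p : M}
    (hX : MDiffAt (T% X) p) (hY : MDiffAt (T% Y) p) (hZ : MDiffAt (T% Z) p) :
    inner ℝ (leviCivita E M Y p (X p)) (Z p) = koszul X Y Z p :=
  inner_leviCivitaFun hX hY hZ

/-- The Levi-Civita connection is torsion-free. -/
theorem torsion_leviCivita : (leviCivita E M).torsion = 0 := by
  rw [CovariantDerivative.torsion_eq_zero_iff]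
  intro X Y p hX hY
  refine ext_inner_right ℝ fun z ↦ ?_
  have hz := inner_leviCivita hX hY (mdiffAt_extend z)
  have hz' := inner_leviCivita hY hX (mdiffAt_extend z)
  rw [extend_apply_self] at hz hz'
  rw [inner_sub_left, hz, hz', koszul, koszul, mlieBracket_swap_apply (V := Y) (W := X)]
  simp [real_inner_comm]
  ring

/-- The Levi-Civita connection is compatible with the metric. -/
theorem mvfderiv_inner_leviCivita {X Y Z : Π x : M, TangentSpace 𝓘(ℝ, E) x} {p : M}
    (hX : MDiffAt (T% X) p) (hY : MDiffAt (T% Y) p) (hZ : MDiffAt (T% Z) p) :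
    d% (fun q ↦ inner ℝ (Y q) (Z q)) p (X p) =
      inner ℝ (leviCivita E M Y p (X p)) (Z p) + inner ℝ (Y p) (leviCivita E M Z p (X p)) := by
  have h1 := inner_leviCivita hX hY hZ
  have h2 := inner_leviCivita hX hZ hY
  rw [h1, real_inner_comm, h2, koszul, koszul, mlieBracket_swap_apply (V := Z) (W := Y)]
  simp [real_inner_comm]
  ring

end LeviCivita
section Curvature

variable {E : Type*} [NormedAddCommGroup E] [NormedSpace ℝ E] [FiniteDimensional ℝ E]
  {M : Type*} [TopologicalSpace M] [ChartedSpace E M] [IsManifold 𝓘(ℝ, E) ∞ M]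
  [RiemannianBundle (fun x : M ↦ TangentSpace 𝓘(ℝ, E) x)]
  [IsContMDiffRiemannianBundle 𝓘(ℝ, E) ∞ E (fun x : M ↦ TangentSpace 𝓘(ℝ, E) x)]

/-- The curvature operator on vector fields,
`R(X, Y)Z = ∇_X ∇_Y Z - ∇_Y ∇_X Z - ∇_[X, Y] Z`, at the point `p`. -/
def curvatureField (X Y Z : Π x : M, TangentSpace 𝓘(ℝ, E) x) (p : M) : TangentSpace 𝓘(ℝ, E) p :=
  leviCivita E M (fun q ↦ leviCivita E M Z q (Y q)) p (X p)
    - leviCivita E M (fun q ↦ leviCivita E M Z q (X q)) p (Y p)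
    - leviCivita E M Z p (mlieBracket 𝓘(ℝ, E) X Y p)

/-- The curvature tensor `R(x, y, z, u) = ⟨R(x, y)z, u⟩` at `p`. The tangent vectors `x, y, z` are
extended to vector fields that are smooth near `p`; the value does not depend on the extension. -/
def curvatureTensor (p : M) (x y z u : TangentSpace 𝓘(ℝ, E) p) : ℝ :=
  inner ℝ (curvatureField (extend E x) (extend E y) (extend E z) p) u

/-- `{x, y}` is orthonormal, hence an orthonormal basis of the 2-plane it spans. Every 2-plane
has such a basis, so quantifying over 2-planes is quantifying over orthonormal pairs. -/
def IsOrthonormalPair (p : M) (x y : TangentSpace 𝓘(ℝ, E) p) : Prop :=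
  inner ℝ x x = (1 : ℝ) ∧ inner ℝ y y = (1 : ℝ) ∧ inner ℝ x y = (0 : ℝ)

/-- The sectional curvature `R(x, y, y, x)` of the 2-plane with orthonormal basis `{x, y}`. -/
def sectionalCurvature (p : M) (x y : TangentSpace 𝓘(ℝ, E) p) : ℝ :=
  curvatureTensor p x y y x

variable (E M) in
/-- `M` has constant sectional curvature. -/
def HasConstantSectionalCurvature : Prop :=
  ∃ c : ℝ, ∀ (p : M) (x y : TangentSpace 𝓘(ℝ, E) p),
    IsOrthonormalPair p x y → sectionalCurvature p x y = c

variable (E M) in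
/-- An almost Hermitian structure on the Riemannian manifold `M`: a smooth field `J` of
endomorphisms of the tangent spaces with `J² = -1` for which the metric is `J`-invariant. -/
structure AlmostHermitianStructure where
  /-- The almost complex structure. -/
  J : Π p : M, TangentSpace 𝓘(ℝ, E) p →L[ℝ] TangentSpace 𝓘(ℝ, E) p
  contMDiff : ContMDiff 𝓘(ℝ, E) (𝓘(ℝ, E).prod 𝓘(ℝ, E →L[ℝ] E)) ∞
    (fun p ↦ TotalSpace.mk' (E →L[ℝ] E)
      (E := fun p : M ↦ TangentSpace 𝓘(ℝ, E) p →L[ℝ] TangentSpace 𝓘(ℝ, E) p) p (J p))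
  J_J : ∀ (p : M) (x : TangentSpace 𝓘(ℝ, E) p), J p (J p x) = -x
  inner_J_J : ∀ (p : M) (x y : TangentSpace 𝓘(ℝ, E) p),
    inner ℝ (J p x) (J p y) = (inner ℝ x y : ℝ)

namespace AlmostHermitianStructure

variable (A : AlmostHermitianStructure E M)

/-- The angle in `[0, π/2]` between the 2-plane `α` with orthonormal basis `{x, y}` and `Jα`:
its cosine is `|g(x, Jy)|`. -/
def planeAngle (p : M) (x y : TangentSpace 𝓘(ℝ, E) p) : ℝ :=
  Real.arccos |(inner ℝ x (A.J p y) : ℝ)|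

/-- `M` has pointwise constant `θ`-holomorphic sectional curvature. -/
def HasPointwiseConstantHolomorphicCurvature (θ : ℝ) : Prop :=
  ∃ c : M → ℝ, ∀ (p : M) (x y : TangentSpace 𝓘(ℝ, E) p),
    IsOrthonormalPair p x y → A.planeAngle p x y = θ → sectionalCurvature p x y = c p

/-- `M` has constant `θ`-holomorphic sectional curvature. -/
def HasConstantHolomorphicCurvature (θ : ℝ) : Prop :=
  ∃ c : ℝ, ∀ (p : M) (x y : TangentSpace 𝓘(ℝ, E) p),
    IsOrthonormalPair p x y → A.planeAngle p x y = θ → sectionalCurvature p x y = c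

/-- `M` is Kähler: `∇J = 0`, that is, `∇_x (JY) = J ∇_x Y` for every tangent vector `x` and every
vector field `Y` differentiable at the base point of `x`. -/
def IsKahler : Prop :=
  ∀ (p : M) (Y : Π q : M, TangentSpace 𝓘(ℝ, E) q), MDiffAt (T% Y) p →
    ∀ x : TangentSpace 𝓘(ℝ, E) p,
      leviCivita E M (fun q ↦ A.J q (Y q)) p x = A.J p (leviCivita E M Y p x)

end AlmostHermitianStructure

end Curvature

end AlmostHermitian

end

/-! The hypothesis determines the whole curvature tensor at each point, and the second Bianchi
identity then forces its coefficients to be constant.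

Pointwise: let `C = cos θ`, `S = sin θ`, and let `x`, `y` be unit vectors with `y` orthogonal to `x`
and `Jx`. The planes spanned by `x` and `C Jx ± S y` both have angle `θ`. Comparing the two signs
gives `R(x, Jx, y, x) = 0` and `C² H(x) + S² K(x, y) = c`, where `H(x) = K(x, Jx)`. As `K` is
symmetric, `H` agrees on Hermitian-orthogonal unit vectors, hence on all unit vectors, because in
dimension at least 6 any two vectors have a common Hermitian-orthogonal one. So `K(x, y)` is also
constant on totally real planes, and polarisation gives `R = ν π₁ + μ π₂`, the tensor of a
generalized complex space form (`exists_formCurv`).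

Globally: `ν` and `μ` are differentiable, since they solve a linear system with smooth coefficients
(`mdiffAt_coefficients`). Substituting `R` into the second Bianchi identity (`bianchiIdentity`)
gives a linear relation between `dν`, `dμ` and `μ ∇J`. Evaluated on suitable Hermitian-orthogonal
vectors it yields `dν = 0` (Schur's argument), `dμ = 0`, and `μ ∇J = 0`, the last by first showing
`μ (∇_x J) x = 0`. By connectedness `ν` and `μ` are constant. If `μ = 0` the sectional curvature is
`ν`; otherwise `∇J = 0`, and a plane of angle `φ` has curvature `ν + 3 μ cos² φ`. -/

namespace AlmostHermitian

/-! ### Curvature-like tensors on a Hermitian vector space. -/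

section LinearAlgebra

variable {V : Type*} [NormedAddCommGroup V] [InnerProductSpace ℝ V]

theorem inner_normalize_self {z : V} (hz : z ≠ 0) :
    inner ℝ (‖z‖⁻¹ • z) (‖z‖⁻¹ • z) = (1 : ℝ) := by
  have hn : ‖z‖ ≠ 0 := norm_ne_zero_iff.2 hz
  rw [real_inner_smul_left, real_inner_smul_right, real_inner_self_eq_norm_sq]
  field_simp

/-- The algebraic symmetries of a Riemannian curvature tensor `R(x, y, z, u)`. -/
structure IsCurvatureLike (R : V → V → V → V → ℝ) : Prop where
  add_left : ∀ x x' y z u, R (x + x') y z u = R x y z u + R x' y z u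
  smul_left : ∀ (c : ℝ) x y z u, R (c • x) y z u = c * R x y z u
  add_right : ∀ x y z u u', R x y z (u + u') = R x y z u + R x y z u'
  smul_right : ∀ (c : ℝ) x y z u, R x y z (c • u) = c * R x y z u
  swap_left : ∀ x y z u, R x y z u = - R y x z u
  swap_right : ∀ x y z u, R x y z u = - R x y u z
  bianchi : ∀ x y z u, R x y z u + R y z x u + R z x y u = 0

namespace IsCurvatureLike

variable {R S : V → V → V → V → ℝ}

/-- The octahedron argument: the Bianchi identities for the four cyclic shifts of `(x, y, z, u)`,
combined after sign normalisation, leave only the two terms to be compared. -/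
theorem pair_symm (h : IsCurvatureLike R) (x y z u : V) : R x y z u = R z u x y := by
  have h1 := h.bianchi x y z u
  have h2 := h.bianchi y z u x
  have h3 := h.bianchi z u x y
  have h4 := h.bianchi u x y z
  have a1 := h.swap_right y z x u
  have a2 := h.swap_right z x y u
  have a3 := h.swap_right x y z u
  have a4 := h.swap_right z u y x
  have a5 := h.swap_right u y z x
  have a6 := h.swap_right u x z y
  have a7 := h.swap_right x z u y
  have b1 := h.swap_left z x u y
  have b2 := h.swap_left u y z x
  have b3 := h.swap_left u y x z
  have b4 := h.swap_left z x y u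
  have b5 := h.swap_left u x y z
  have b6 := h.swap_left x y u z
  linarith

theorem add_two (h : IsCurvatureLike R) (x y y' z u : V) :
    R x (y + y') z u = R x y z u + R x y' z u := by
  rw [h.swap_left, h.add_left, h.swap_left x y, h.swap_left x y']; ring

theorem smul_two (h : IsCurvatureLike R) (c : ℝ) (x y z u : V) :
    R x (c • y) z u = c * R x y z u := by
  rw [h.swap_left, h.smul_left, h.swap_left x y]; ring

theorem add_three (h : IsCurvatureLike R) (x y z z' u : V) :
    R x y (z + z') u = R x y z u + R x y z' u := by
  rw [h.swap_right, h.add_right, h.swap_right x y z, h.swap_right x y z']; ring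

theorem smul_three (h : IsCurvatureLike R) (c : ℝ) (x y z u : V) :
    R x y (c • z) u = c * R x y z u := by
  rw [h.swap_right, h.smul_right, h.swap_right x y z]; ring

theorem self_left (h : IsCurvatureLike R) (x z u : V) : R x x z u = 0 := by
  have := h.swap_left x x z u; linarith

theorem self_right (h : IsCurvatureLike R) (x y z : V) : R x y z z = 0 := by
  have := h.swap_right x y z z; linarith

theorem zero_left (h : IsCurvatureLike R) (y z u : V) : R 0 y z u = 0 := by
  simpa using h.smul_left 0 0 y z u

theorem outer_symm (h : IsCurvatureLike R) (x y z : V) : R x z y x = R x y z x := by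
  rw [h.pair_symm, h.swap_left, h.swap_right]; ring

/-- A curvature-like tensor is determined by its sectional curvatures. -/
theorem eq_zero_of_sectional (h : IsCurvatureLike R) (h0 : ∀ x y, R x y y x = 0) (x y z u : V) :
    R x y z u = 0 := by
  have h1 : ∀ x y z, R x y z x = 0 := by
    intro x y z
    have := h0 x (y + z)
    rw [h.add_two, h.add_three, h.add_three, h0, h0, h.outer_symm x y z] at this
    linarith
  have h2 : ∀ x y z u, R x y z u = - R u y z x := by
    intro x y z u
    have := h1 (x + u) y z
    rw [h.add_left, h.add_right, h.add_right, h1, h1] at this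
    linarith
  -- Polarising in the inner and then the outer pair has made `R` invariant under cyclic shifts of
  -- its first three arguments, so the Bianchi identity reads `3 R = 0`.
  have h3 : ∀ x y z u, R x y z u = R z x y u := by
    intro x y z u
    rw [h2, h.pair_symm, h.swap_right z x y u]
  have := h.bianchi x y z u
  have e1 := h3 x y z u
  have e2 := h3 y z x u
  linarith

theorem sub (h : IsCurvatureLike R) (h' : IsCurvatureLike S) :
    IsCurvatureLike (fun x y z u ↦ R x y z u - S x y z u) where
  add_left x x' y z u := by rw [h.add_left, h'.add_left]; ring
  smul_left c x y z u := by rw [h.smul_left, h'.smul_left]; ring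
  add_right x y z u u' := by rw [h.add_right, h'.add_right]; ring
  smul_right c x y z u := by rw [h.smul_right, h'.smul_right]; ring
  swap_left x y z u := by rw [h.swap_left, h'.swap_left]; ring
  swap_right x y z u := by rw [h.swap_right, h'.swap_right]; ring
  bianchi x y z u := by linear_combination h.bianchi x y z u - h'.bianchi x y z u

end IsCurvatureLike

/-- `J` is an orthogonal complex structure. -/
structure IsOrthogonalComplex (J : V →L[ℝ] V) : Prop where
  sq : ∀ x, J (J x) = -x
  inner_map : ∀ x y, inner ℝ (J x) (J y) = (inner ℝ x y : ℝ)

namespace IsOrthogonalComplex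

variable {J : V →L[ℝ] V}

theorem inner_left (hJ : IsOrthogonalComplex J) (x y : V) :
    inner ℝ (J x) y = -(inner ℝ x (J y) : ℝ) := by
  rw [← hJ.inner_map x (J y), hJ.sq, inner_neg_right, neg_neg]

theorem inner_self (hJ : IsOrthogonalComplex J) (x : V) : inner ℝ x (J x) = (0 : ℝ) := by
  have := hJ.inner_left x x
  rw [real_inner_comm] at this
  linarith

theorem inner_swap (hJ : IsOrthogonalComplex J) (x y : V) :
    inner ℝ x (J y) = -(inner ℝ y (J x) : ℝ) := by
  rw [← hJ.inner_left, real_inner_comm]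

/-- In real dimension at least `6`, two complex lines have a common orthogonal unit vector. -/
theorem exists_unit_orthogonal (hJ : IsOrthogonalComplex J) (hV : 6 ≤ Module.finrank ℝ V)
    (x y : V) : ∃ z : V, inner ℝ z z = (1 : ℝ) ∧ inner ℝ x z = (0 : ℝ) ∧ inner ℝ x (J z) = (0 : ℝ) ∧
      inner ℝ y z = (0 : ℝ) ∧ inner ℝ y (J z) = (0 : ℝ) := by
  classical
  let s : Finset V := {x, J x, y, J y}
  have hs : Module.finrank ℝ (Submodule.span ℝ (s : Set V)) < Module.finrank ℝ V :=
    ((finrank_span_finset_le_card s).trans Finset.card_le_four).trans_lt (by omega)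
  have hne : (Submodule.span ℝ (s : Set V))ᗮ ≠ ⊥ := by
    intro h
    rw [Submodule.orthogonal_eq_bot_iff] at h
    rw [h, finrank_top] at hs
    exact lt_irrefl _ hs
  obtain ⟨z, hz, hz0⟩ := Submodule.exists_mem_ne_zero_of_ne_bot hne
  rw [Submodule.mem_orthogonal] at hz
  have hin : ∀ v ∈ s, inner ℝ v z = (0 : ℝ) := fun v hv ↦ hz v (Submodule.subset_span hv)
  have e1 := hin x (by simp [s])
  have e2 := hin (J x) (by simp [s])
  have e3 := hin y (by simp [s])
  have e4 := hin (J y) (by simp [s])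
  rw [hJ.inner_left, neg_eq_zero] at e2 e4
  refine ⟨‖z‖⁻¹ • z, inner_normalize_self hz0, ?_, ?_, ?_, ?_⟩ <;>
    simp [inner_smul_right, e1, e2, e3, e4]

end IsOrthogonalComplex

variable (J : V →L[ℝ] V)

/-- The curvature tensor of constant sectional curvature `1`, as an operator. -/
def unitCurv (x y z : V) : V := (inner ℝ y z : ℝ) • x - (inner ℝ x z : ℝ) • y

/-- The `J`-part of the curvature operator of a complex space form. -/
def complexCurv (x y z : V) : V :=
  (inner ℝ x (J z) : ℝ) • J y - (inner ℝ y (J z) : ℝ) • J x + (2 * inner ℝ x (J y) : ℝ) • J z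

/-- The curvature operator of a generalized complex space form. -/
def formCurv (ν μ : ℝ) (x y z : V) : V := ν • unitCurv x y z + μ • complexCurv J x y z

variable {J}

theorem inner_formCurv (hJ : IsOrthogonalComplex J) (ν μ : ℝ) (x y z u : V) :
    inner ℝ (formCurv J ν μ x y z) u =
      ν * (inner ℝ y z * inner ℝ x u - inner ℝ x z * inner ℝ y u)
      + μ * (inner ℝ y (J z) * inner ℝ x (J u) - inner ℝ x (J z) * inner ℝ y (J u)
        - 2 * inner ℝ x (J y) * inner ℝ z (J u)) := by
  simp only [formCurv, unitCurv, complexCurv, inner_add_left, inner_sub_left, real_inner_smul_left,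
    hJ.inner_left]
  ring

theorem isCurvatureLike_formCurv (hJ : IsOrthogonalComplex J) (ν μ : ℝ) :
    IsCurvatureLike (fun x y z u ↦ inner ℝ (formCurv J ν μ x y z) u) := by
  have hsw := hJ.inner_swap
  constructor <;> intros <;> simp only [inner_formCurv hJ, map_add, map_smul, inner_add_left,
    inner_add_right, real_inner_smul_left, real_inner_smul_right]
  · ring
  · ring
  · ring
  · ring
  · rename_i x y z u
    rw [hsw x y]; ring
  · rename_i x y z u
    rw [hsw z u]; ring
  · rename_i x y z u
    rw [hsw x z, hsw y x, hsw z y, real_inner_comm x z, real_inner_comm y x, real_inner_comm z y]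
    ring

/-- Identifies the coefficients: `ν` is the curvature of totally real planes and `ν + 3 μ` that of
holomorphic planes. -/
theorem formCurv_sectional (hJ : IsOrthogonalComplex J) (ν μ : ℝ) (x y : V) :
    inner ℝ (formCurv J ν μ x y y) x =
      ν * (inner ℝ x x * inner ℝ y y - inner ℝ x y ^ 2) + 3 * μ * inner ℝ x (J y) ^ 2 := by
  rw [inner_formCurv hJ, hJ.inner_self, hJ.inner_self, hJ.inner_swap y x, real_inner_comm x y]
  ring

/-- If all planes of a fixed angle `θ ∈ (0, π/2)`, with `C = cos θ`, have the same
curvature, then `R` is the curvature tensor of a generalized complex space form. -/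
theorem exists_formCurv (hJ : IsOrthogonalComplex J) (hV : 6 ≤ Module.finrank ℝ V)
    {R : V → V → V → V → ℝ} (hR : IsCurvatureLike R) {C S c : ℝ} (hC : 0 < C) (hS : 0 < S)
    (hCS : C ^ 2 + S ^ 2 = 1)
    (hc : ∀ x y : V, inner ℝ x x = (1 : ℝ) → inner ℝ y y = (1 : ℝ) → inner ℝ x y = (0 : ℝ) →
      |(inner ℝ x (J y) : ℝ)| = C → R x y y x = c) :
    ∃ ν μ : ℝ, ∀ x y z u, R x y z u = inner ℝ (formCurv J ν μ x y z) u := by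
  have key : ∀ x y : V, inner ℝ x x = (1 : ℝ) → inner ℝ y y = (1 : ℝ) → inner ℝ x y = (0 : ℝ) →
      inner ℝ x (J y) = (0 : ℝ) → R x (J x) y x = 0 ∧
        C ^ 2 * R x (J x) (J x) x + S ^ 2 * R x y y x = c := by
    intro x y hx hy hxy hxJy
    have e : ∀ s : ℝ, s ^ 2 = 1 →
        C ^ 2 * R x (J x) (J x) x + 2 * C * S * s * R x (J x) y x + S ^ 2 * R x y y x = c := by
      intro s hs
      -- For `s = ±1` this vector is a unit vector orthogonal to `x`, and its image under `J` has
      -- inner product `-C` with `x`; the plane therefore has angle `θ`.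
      rw [← hc x (C • J x + (S * s) • y) hx]
      · simp only [hR.add_two, hR.add_three, hR.smul_two, hR.smul_three, hR.outer_symm x (J x) y]
        linear_combination (-S ^ 2 * R x y y x) * hs
      · have h1 : inner ℝ (J x) y = (0 : ℝ) := by rw [hJ.inner_left, hxJy, neg_zero]
        have h2 : inner ℝ y (J x) = (0 : ℝ) := by rw [real_inner_comm, h1]
        simp only [inner_add_left, inner_add_right, real_inner_smul_left, real_inner_smul_right,
          hJ.inner_map, hx, hy, h1, h2]
        linear_combination hCS + S ^ 2 * hs
      · simp [inner_add_right, real_inner_smul_right, hJ.inner_self, hxy]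
      · simp only [map_add, map_smul, inner_add_right, real_inner_smul_right, hJ.sq,
          inner_neg_right, hx, hxJy]
        rw [mul_neg_one, mul_zero, add_zero, abs_neg, abs_of_pos hC]
    have e1 := e 1 (by norm_num)
    have e2 := e (-1) (by norm_num)
    have h0 : C * S * R x (J x) y x = 0 := by linarith
    have h0' : R x (J x) y x = 0 := by
      simpa [hC.ne', hS.ne'] using h0
    refine ⟨h0', ?_⟩
    rw [h0'] at e1
    linarith
  have hH : ∀ x y : V, inner ℝ x x = (1 : ℝ) → inner ℝ y y = (1 : ℝ) →
      R x (J x) (J x) x = R y (J y) (J y) y := by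
    have aux : ∀ x y : V, inner ℝ x x = (1 : ℝ) → inner ℝ y y = (1 : ℝ) → inner ℝ x y = (0 : ℝ) →
        inner ℝ x (J y) = (0 : ℝ) → R x (J x) (J x) x = R y (J y) (J y) y := by
      intro x y hx hy hxy hxJy
      have h1 := (key x y hx hy hxy hxJy).2
      have h2 := (key y x hy hx (by rw [real_inner_comm, hxy])
        (by rw [hJ.inner_swap, hxJy, neg_zero])).2
      rw [hR.pair_symm y x x y] at h2
      have h3 : C ^ 2 * (R x (J x) (J x) x - R y (J y) (J y) y) = 0 := by linarith
      have := (mul_eq_zero.1 h3).resolve_left (by positivity)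
      linarith
    intro x y hx hy
    obtain ⟨z, hz, hxz, hxJz, hyz, hyJz⟩ := hJ.exists_unit_orthogonal hV x y
    -- `x` and `y` need not be orthogonal, so both are compared with a `z` orthogonal to their
    -- complex lines.
    rw [aux x z hx hz hxz hxJz, aux y z hy hz hyz hyJz]
  obtain ⟨x₀, hx₀, -⟩ := hJ.exists_unit_orthogonal hV 0 0
  set H := R x₀ (J x₀) (J x₀) x₀ with hHdef
  -- `ν` is the totally real curvature read off from `C² H + S² K = c`, and `μ` is chosen so that `ν
  -- + 3 μ = H`.
  refine ⟨(c - C ^ 2 * H) / S ^ 2, (H - (c - C ^ 2 * H) / S ^ 2) / 3, fun x y z u ↦ ?_⟩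
  set ν := (c - C ^ 2 * H) / S ^ 2 with hν
  set μ := (H - ν) / 3 with hμ
  have hνS : S ^ 2 * ν = c - C ^ 2 * H := by rw [hν]; field_simp
  have hD := hR.sub (isCurvatureLike_formCurv hJ ν μ)
  set D : V → V → V → V → ℝ := fun x y z u ↦ R x y z u - inner ℝ (formCurv J ν μ x y z) u with hDdef
  suffices ∀ x y z u, D x y z u = 0 from sub_eq_zero.1 (this x y z u)
  clear x y z u
  refine hD.eq_zero_of_sectional fun x y ↦ ?_
  have hDH : ∀ x : V, inner ℝ x x = (1 : ℝ) → D x (J x) (J x) x = 0 := by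
    intro x hx
    simp only [hDdef]
    rw [formCurv_sectional hJ, hH x x₀ hx hx₀, hJ.inner_map, hJ.inner_self, hJ.sq, inner_neg_right,
      hx, ← hHdef, hμ]
    ring
  have hDK : ∀ x y : V, inner ℝ x x = (1 : ℝ) → inner ℝ x y = (0 : ℝ) → inner ℝ x (J y) = (0 : ℝ) →
      D x (J x) y x = 0 ∧ D x y y x = 0 := by
    intro x y hx hxy hxJy
    by_cases hy0 : y = 0
    · subst hy0
      refine ⟨?_, ?_⟩
      · simpa using hD.smul_three 0 x (J x) 0 x
      · simpa using hD.smul_three 0 x 0 0 x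
    have hn : ‖y‖ ≠ 0 := norm_ne_zero_iff.2 hy0
    obtain ⟨w, hw⟩ : ∃ w, w = ‖y‖⁻¹ • y := ⟨_, rfl⟩
    have hyw : y = ‖y‖ • w := by rw [hw, smul_smul, mul_inv_cancel₀ hn, one_smul]
    have hww : inner ℝ w w = (1 : ℝ) := by rw [hw]; exact inner_normalize_self hy0
    have hxw : inner ℝ x w = (0 : ℝ) := by simp [hw, inner_smul_right, hxy]
    have hxJw : inner ℝ x (J w) = (0 : ℝ) := by simp [hw, inner_smul_right, hxJy]
    have hwJx : inner ℝ w (J x) = (0 : ℝ) := by rw [hJ.inner_swap, hxJw, neg_zero]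
    obtain ⟨k1, k2⟩ := key x w hx hww hxw hxJw
    have h1 : D x (J x) w x = 0 := by
      simp only [hDdef]
      simp only [k1, inner_formCurv hJ, hJ.inner_left, hJ.inner_self, hxw, hxJw, hwJx]
      ring
    have h2 : D x w w x = 0 := by
      simp only [hDdef]
      rw [formCurv_sectional hJ, hx, hww, hxw, hxJw]
      rw [hH x x₀ hx hx₀, ← hHdef] at k2
      have : S ^ 2 * (R x w w x - ν) = 0 := by linear_combination k2 - hνS
      have := (mul_eq_zero.1 this).resolve_left (by positivity)
      linear_combination this
    rw [hyw]
    simp only [hD.smul_two, hD.smul_three, h1, h2, mul_zero, and_self]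
  have hunit : ∀ x y : V, inner ℝ x x = (1 : ℝ) → D x y y x = 0 := by
    intro x y hx
    obtain ⟨a, ha⟩ : ∃ a : ℝ, a = inner ℝ x y := ⟨_, rfl⟩
    obtain ⟨b, hb⟩ : ∃ b : ℝ, b = inner ℝ (J x) y := ⟨_, rfl⟩
    -- Splitting `y` along `x`, `Jx` and their orthogonal complement expresses `D x y y x` through
    -- values of `D` already known to vanish.
    obtain ⟨w, hw⟩ : ∃ w, w = y - a • x - b • J x := ⟨_, rfl⟩
    have hy : y = a • x + (b • J x + w) := by rw [hw]; abel
    have hxw : inner ℝ x w = (0 : ℝ) := by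
      simp only [hw, inner_sub_right, real_inner_smul_right, hx, hJ.inner_self, ha]
      ring
    have hxJw : inner ℝ x (J w) = (0 : ℝ) := by
      rw [hJ.inner_left] at hb
      simp only [hw, map_sub, map_smul, inner_sub_right, real_inner_smul_right, hx, hJ.inner_self,
        hb, hJ.sq, inner_neg_right]
      ring
    obtain ⟨h1, h2⟩ := hDK x w hx hxw hxJw
    have h3 : D x w (J x) x = 0 := by rw [hD.outer_symm x (J x) w, h1]
    rw [hy]
    simp only [hD.add_two, hD.add_three, hD.smul_two, hD.smul_three, hD.self_left, hDH x hx, h1, h2,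
      h3, hD.self_right]
    ring
  by_cases hx0 : x = 0
  · rw [hx0, hD.zero_left]
  have hn : ‖x‖ ≠ 0 := norm_ne_zero_iff.2 hx0
  have hu := hunit (‖x‖⁻¹ • x) y (inner_normalize_self hx0)
  rw [hD.smul_left, hD.smul_right] at hu
  simpa [hx0] using hu

end LinearAlgebra

/-! ### Pointwise consequences of the second Bianchi identity. -/

section BianchiAlgebra

variable {V : Type*} [NormedAddCommGroup V] [InnerProductSpace ℝ V]

/-- The algebraic properties of `α(x, a, b) = ⟨a, (∇_x J) b⟩`. -/
structure IsNablaComplex (J : V →L[ℝ] V) (α : V → V → V → ℝ) : Prop where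
  add_left : ∀ x x' a b, α (x + x') a b = α x a b + α x' a b
  add_right : ∀ x a b b', α x a (b + b') = α x a b + α x a b'
  smul_right : ∀ (c : ℝ) x a b, α x a (c • b) = c * α x a b
  swap : ∀ x a b, α x a b = - α x b a
  map_left : ∀ x a b, α x (J a) b = α x a (J b)

/-- The summand of the second Bianchi identity for a curvature tensor `ν π₁ + μ π₂`, where `dν`,
`dμ` and `α` are the derivatives of `ν`, `μ` and `J`. -/
def bianchiTerm (J : V →L[ℝ] V) (dν dμ : V → ℝ) (μ : ℝ) (α : V → V → V → ℝ) (x y z w u : V) : ℝ :=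
  dν x * (inner ℝ z w * inner ℝ y u - inner ℝ y w * inner ℝ z u)
    + dμ x * (inner ℝ z (J w) * inner ℝ y (J u) - inner ℝ y (J w) * inner ℝ z (J u)
        - 2 * inner ℝ y (J z) * inner ℝ w (J u))
    + μ * (α x z w * inner ℝ y (J u) + inner ℝ z (J w) * α x y u
        - α x y w * inner ℝ z (J u) - inner ℝ y (J w) * α x z u
        - 2 * α x y z * inner ℝ w (J u) - 2 * inner ℝ y (J z) * α x w u)

/-- The second Bianchi identity for a curvature tensor `ν π₁ + μ π₂`. -/
def BianchiIdentity (J : V →L[ℝ] V) (dν dμ : V → ℝ) (μ : ℝ) (α : V → V → V → ℝ) : Prop :=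
  ∀ x y z w u, bianchiTerm J dν dμ μ α x y z w u + bianchiTerm J dν dμ μ α y z x w u
      + bianchiTerm J dν dμ μ α z x y w u = 0

variable {J : V →L[ℝ] V} {α : V → V → V → ℝ} {dν dμ : V → ℝ} {μ : ℝ}

/-- The component of `⟨a, a⟩ b` orthogonal to the complex line of `a`. -/
def complexReject (J : V →L[ℝ] V) (a b : V) : V :=
  (inner ℝ a a : ℝ) • b + ((-inner ℝ a b : ℝ) • a + (inner ℝ a (J b) : ℝ) • J a)

theorem inner_complexReject (hJ : IsOrthogonalComplex J) (a b : V) :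
    inner ℝ a (complexReject J a b) = (0 : ℝ) := by
  simp only [complexReject, inner_add_right, real_inner_smul_right, hJ.inner_self]
  ring

theorem inner_map_complexReject (hJ : IsOrthogonalComplex J) (a b : V) :
    inner ℝ a (J (complexReject J a b)) = (0 : ℝ) := by
  simp only [complexReject, map_add, map_smul, inner_add_right, real_inner_smul_right,
    hJ.inner_self, hJ.sq, inner_neg_right]
  ring

theorem inner_complexReject_of_orthogonal (hJ : IsOrthogonalComplex J)
    {a b c : V} (h₁ : inner ℝ c a = (0 : ℝ)) (h₂ : inner ℝ c (J a) = (0 : ℝ))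
    (h₃ : inner ℝ c b = (0 : ℝ)) (h₄ : inner ℝ c (J b) = (0 : ℝ)) :
    inner ℝ c (complexReject J a b) = (0 : ℝ) ∧ inner ℝ c (J (complexReject J a b)) = (0 : ℝ) := by
  simp [complexReject, inner_add_right, real_inner_smul_right, h₁, h₂, h₃, h₄, hJ.sq]

namespace IsNablaComplex

theorem self (h : IsNablaComplex J α) (x a : V) : α x a a = 0 := by
  have := h.swap x a a; linarith

theorem self_map (h : IsNablaComplex J α) (x a : V) : α x a (J a) = 0 := by
  have h1 := h.map_left x a a
  have h2 := h.swap x (J a) a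
  linarith

/-- The Bianchi identity on `(x, Jz, z; w, Jw)` with a unit `w` orthogonal to the complex lines of
`x` and `z`: only the terms containing `⟨w, J(Jw)⟩ = -1` survive. -/
theorem differential_add (h : IsNablaComplex J α) (hJ : IsOrthogonalComplex J)
    (hV : 6 ≤ Module.finrank ℝ V) (hB : BianchiIdentity J dν dμ μ α)
    {x z : V} (hz : inner ℝ z z = (1 : ℝ)) (hxz : inner ℝ x z = (0 : ℝ))
    (hxJz : inner ℝ x (J z) = (0 : ℝ)) :
    dμ x + μ * (α (J z) z x + α z x (J z)) = 0 := by
  obtain ⟨w, hw, hxw, hxJw, hzw, hzJw⟩ := hJ.exists_unit_orthogonal hV x z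
  have hzJx : inner ℝ z (J x) = (0 : ℝ) := by rw [hJ.inner_swap, hxJz, neg_zero]
  have := hB x (J z) z w (J w)
  simp only [bianchiTerm, hJ.sq, map_neg, inner_neg_right, hJ.inner_left, hz, hxz, hw,
    hxw, hxJw, hzw, hzJw, hzJx, h.self_map, h.map_left] at this
  linarith

theorem complexReject_right (h : IsNablaComplex J α) (x y a b : V) :
    α x y (complexReject J a b) = inner ℝ a a * α x y b - inner ℝ a b * α x y a
      + inner ℝ a (J b) * α x y (J a) := by
  rw [complexReject, h.add_right, h.add_right, h.smul_right, h.smul_right, h.smul_right]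
  ring

theorem zero_left (h : IsNablaComplex J α) (a b : V) : α 0 a b = 0 := by
  simpa using h.add_left 0 0 a b

/-- Where `μ ≠ 0`, the almost complex structure is nearly Kähler: `(∇_x J) x = 0`. -/
theorem mul_self_left (h : IsNablaComplex J α) (hJ : IsOrthogonalComplex J)
    (hV : 6 ≤ Module.finrank ℝ V) (hB : BianchiIdentity J dν dμ μ α)
    (x u : V) : μ * α x x u = 0 := by
  have key : ∀ u, inner ℝ x (J u) = (0 : ℝ) → μ * α x x u = 0 := by
    intro u hxJu
    obtain ⟨z, hz, hxz, hxJz, huz, huJz⟩ := hJ.exists_unit_orthogonal hV x u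
    have hd := h.differential_add hJ hV hB hz hxz hxJz
    have hzx : inner ℝ z x = (0 : ℝ) := by rw [real_inner_comm, hxz]
    have hzJx : inner ℝ z (J x) = (0 : ℝ) := by rw [hJ.inner_swap, hxJz, neg_zero]
    have hzu : inner ℝ z u = (0 : ℝ) := by rw [real_inner_comm, huz]
    have hzJu : inner ℝ z (J u) = (0 : ℝ) := by rw [hJ.inner_swap, huJz, neg_zero]
    -- The orthogonality relations leave only `-2 μ α(x, x, u)` in this instance.
    have := hB x (J z) z x u
    simp only [bianchiTerm, hJ.sq, inner_neg_right, hJ.inner_left, hJ.inner_self, hz, hxz,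
      hzx, hzJx, hzu, hzJu, h.self_map, h.map_left, h.self, hxJu] at this
    linarith
  by_cases hx : x = 0
  · rw [hx, h.zero_left, mul_zero]
  -- The components removed from `u` lie along `x` and `Jx`, on which `α x x` vanishes, so the
  -- restriction on `u` is harmless.
  have h1 := key _ (inner_map_complexReject hJ x u)
  rw [h.complexReject_right, h.self, h.self_map] at h1
  have h2 : (inner ℝ x x : ℝ) ≠ 0 := by simpa using hx
  exact (mul_eq_zero.1 (show (inner ℝ x x : ℝ) * (μ * α x x u) = 0 by linear_combination h1)
    ).resolve_left h2

/-- Polarisation of `mul_self_left`; with `swap` it makes `μ α` totally skew. -/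
theorem mul_swap_left (h : IsNablaComplex J α) (hJ : IsOrthogonalComplex J)
    (hV : 6 ≤ Module.finrank ℝ V) (hB : BianchiIdentity J dν dμ μ α)
    (x y u : V) : μ * α x y u = - (μ * α y x u) := by
  have h1 := h.mul_self_left hJ hV hB (x + y) u
  have h2 := h.mul_self_left hJ hV hB x u
  have h3 := h.mul_self_left hJ hV hB y u
  rw [h.add_left, h.swap x (x + y), h.swap y (x + y), h.add_right, h.add_right, h.swap x u x,
    h.swap x u y, h.swap y u x, h.swap y u y] at h1
  linear_combination h1 - h2 - h3

/-- By skew-symmetry both correction terms in `differential_add` reduce to multiples of `μ α(x, z,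
Jz)`, which is zero. -/
theorem differential_eq_zero (h : IsNablaComplex J α) (hJ : IsOrthogonalComplex J)
    (hV : 6 ≤ Module.finrank ℝ V) (hB : BianchiIdentity J dν dμ μ α) (x : V) : dμ x = 0 := by
  obtain ⟨z, hz, hxz, hxJz, -⟩ := hJ.exists_unit_orthogonal hV x 0
  have hd := h.differential_add hJ hV hB hz hxz hxJz
  have h1 := h.mul_swap_left hJ hV hB (J z) x z
  have h2 := h.mul_swap_left hJ hV hB z x (J z)
  rw [h.map_left, h.self_map] at h1
  rw [h.self_map] at h2
  rw [h.swap (J z) z x] at hd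
  linear_combination hd + h1 - h2

/-- Where `μ ≠ 0`, the almost complex structure is parallel. -/
theorem mul_eq_zero (h : IsNablaComplex J α) (hJ : IsOrthogonalComplex J)
    (hV : 6 ≤ Module.finrank ℝ V) (hB : BianchiIdentity J dν dμ μ α)
    (x y z : V) : μ * α x y z = 0 := by
  have key : ∀ y z, inner ℝ x y = (0 : ℝ) → inner ℝ x (J y) = (0 : ℝ) → inner ℝ x z = (0 : ℝ) →
      inner ℝ x (J z) = (0 : ℝ) → inner ℝ y z = (0 : ℝ) → inner ℝ y (J z) = (0 : ℝ) →
      inner ℝ x x * (μ * α x y z) = 0 := by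
    intro y z hxy hxJy hxz hxJz hyz hyJz
    have hzx : inner ℝ z x = (0 : ℝ) := by rw [real_inner_comm, hxz]
    have hzJx : inner ℝ z (J x) = (0 : ℝ) := by rw [hJ.inner_swap, hxJz, neg_zero]
    have hyx : inner ℝ y x = (0 : ℝ) := by rw [real_inner_comm, hxy]
    have hyJx : inner ℝ y (J x) = (0 : ℝ) := by rw [hJ.inner_swap, hxJy, neg_zero]
    -- The surviving terms are `⟨x, x⟩ μ (2 α(x,y,z) + 3 α(y,z,x) + 3 α(z,x,y))`, which total
    -- skew-symmetry turns into `8 ⟨x, x⟩ μ α(x,y,z)`.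
    have := hB x y z x (J x)
    simp only [bianchiTerm, hJ.sq, inner_neg_right, hJ.inner_self,
      hzx, hzJx, hyx, hyJx, hyJz, h.self_map, h.self,
      h.differential_eq_zero hJ hV hB] at this
    have e1 := h.mul_swap_left hJ hV hB y x z
    have e2 := h.mul_swap_left hJ hV hB z x y
    rw [h.swap x z y] at e2
    rw [h.swap y z x, h.swap z y x] at this
    linear_combination (1 / 8) * this + (3 / 8 * inner ℝ x x) * e1 - (3 / 8 * inner ℝ x x) * e2
  by_cases hx : x = 0
  · rw [hx, h.zero_left, mul_zero]
  have hx' : (inner ℝ x x : ℝ) ≠ 0 := by simpa using hx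
  have hx1 : ∀ u, μ * α x u x = 0 := fun u ↦ by
    rw [h.swap, mul_neg, h.mul_self_left hJ hV hB, neg_zero]
  have hx2 : ∀ u, μ * α x u (J x) = 0 := fun u ↦ by rw [← h.map_left, hx1]
  -- The orthogonality assumptions are removed one at a time by `complexReject`; each discarded
  -- component contributes zero because `μ α` vanishes on repeated complex lines.
  have key' : ∀ y z, inner ℝ x y = (0 : ℝ) → inner ℝ x (J y) = (0 : ℝ) → inner ℝ x z = (0 : ℝ) →
      inner ℝ x (J z) = (0 : ℝ) → μ * α x y z = 0 := by
    intro y z hxy hxJy hxz hxJz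
    by_cases hy : y = 0
    · have : α x z (0 : V) = 0 := by simpa using h.smul_right 0 x z 0
      rw [hy, h.swap, this]; simp
    have hy' : (inner ℝ y y : ℝ) ≠ 0 := by simpa using hy
    obtain ⟨h1, h2⟩ := inner_complexReject_of_orthogonal hJ hxy hxJy hxz hxJz
    have := key y _ hxy hxJy h1 h2 (inner_complexReject hJ y z) (inner_map_complexReject hJ y z)
    rw [h.complexReject_right, h.self, h.self_map] at this
    have h3 : (inner ℝ x x * inner ℝ y y : ℝ) * (μ * α x y z) = 0 := by linear_combination this
    exact (_root_.mul_eq_zero.1 h3).resolve_left (mul_ne_zero hx' hy')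
  have key'' : ∀ y z, inner ℝ x y = (0 : ℝ) → inner ℝ x (J y) = (0 : ℝ) → μ * α x y z = 0 := by
    intro y z hxy hxJy
    have := key' y _ hxy hxJy (inner_complexReject hJ x z) (inner_map_complexReject hJ x z)
    rw [h.complexReject_right] at this
    have h3 : (inner ℝ x x : ℝ) * (μ * α x y z) = 0 := by
      linear_combination this + inner ℝ x z * hx1 y - inner ℝ x (J z) * hx2 y
    exact (_root_.mul_eq_zero.1 h3).resolve_left hx'
  have := key'' _ z (inner_complexReject hJ x y) (inner_map_complexReject hJ x y)
  rw [h.swap, h.complexReject_right] at this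
  have h3 : (inner ℝ x x : ℝ) * (μ * α x y z) = 0 := by
    linear_combination this - inner ℝ x y * hx1 z + inner ℝ x (J y) * hx2 z
      + inner ℝ x x * μ * h.swap x y z
  exact (_root_.mul_eq_zero.1 h3).resolve_left hx'

end IsNablaComplex

/-- Schur's argument: on `(x, y, z; z, y)` with `x`, `y`, `z` pairwise Hermitian-orthogonal, every
term except `dν x` has a vanishing inner product as a factor. -/
theorem BianchiIdentity.differential_eq_zero (hJ : IsOrthogonalComplex J)
    (hV : 6 ≤ Module.finrank ℝ V) (hB : BianchiIdentity J dν dμ μ α) (x : V) : dν x = 0 := by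
  obtain ⟨y, hy, hxy, hxJy, -⟩ := hJ.exists_unit_orthogonal hV x 0
  obtain ⟨z, hz, hxz, hxJz, hyz, hyJz⟩ := hJ.exists_unit_orthogonal hV x y
  have := hB x y z z y
  have hzJy : inner ℝ z (J y) = (0 : ℝ) := by rw [hJ.inner_swap, hyJz, neg_zero]
  have hzJx : inner ℝ z (J x) = (0 : ℝ) := by rw [hJ.inner_swap, hxJz, neg_zero]
  simp only [bianchiTerm, hz, hy, hxz, hxy, hyz, real_inner_comm y z, hJ.inner_self, hzJy, hyJz,
    hxJz, hxJy, hzJx] at this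
  linarith

end BianchiAlgebra

set_option linter.unusedSectionVars false

/-! ### Smoothness of brackets, the Koszul expression and covariant derivatives. -/

section Smoothness

variable {E : Type*} [NormedAddCommGroup E] [NormedSpace ℝ E] [FiniteDimensional ℝ E]
  {M : Type*} [TopologicalSpace M] [ChartedSpace E M] [IsManifold 𝓘(ℝ, E) ∞ M]

/-- The derivative of a smooth function along a smooth vector field is smooth. -/
theorem contMDiffAt_mvfderiv_apply {f : M → ℝ} {X : Π x : M, TangentSpace 𝓘(ℝ, E) x} {p : M}
    (hf : CMDiffAt ∞ f p) (hX : CMDiffAt ∞ (T% X) p) :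
    CMDiffAt ∞ (fun q ↦ d% f q (X q)) p := by
  have h1 := ContMDiffAt.mfderiv_const (m := ∞) hf (by simp)
  have h2 := ContMDiffAt.clm_apply_of_inCoordinates (F₁ := E) (E₁ := TangentSpace 𝓘(ℝ, E) (M := M))
    (F₂ := ℝ) (E₂ := TangentSpace 𝓘(ℝ, ℝ) (M := ℝ)) (b₁ := id) (b₂ := f)
    (ϕ := fun q ↦ mfderiv% f q) (v := X) h1 hX hf
  rw [contMDiffAt_totalSpace] at h2
  simpa using! h2.2

theorem contMDiffAt_mlieBracket {X Y : Π x : M, TangentSpace 𝓘(ℝ, E) x} {p : M}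
    (hX : CMDiffAt ∞ (T% X) p) (hY : CMDiffAt ∞ (T% Y) p) :
    CMDiffAt ∞ (T% (mlieBracket 𝓘(ℝ, E) X Y)) p := by
  have : IsManifold 𝓘(ℝ, E) (minSmoothness ℝ 2) M := by
    rw [minSmoothness_of_isRCLikeNormedField]; infer_instance
  have : IsManifold 𝓘(ℝ, E) (((⊤ : ℕ∞) : ℕ∞ω) + 1) M := by simpa
  exact ContMDiffAt.mlieBracket_vectorField (n := ⊤) (m := ⊤) hX hY (by simp)

/-- Being `C^∞` at a point does not propagate to a neighbourhood, as the neighbourhoods may shrink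
with the order; being `C^1` does, and it suffices here. -/
theorem _root_.ContMDiffAt.eventually_mdiffAt {X : Π x : M, TangentSpace 𝓘(ℝ, E) x} {p : M}
    (hX : CMDiffAt ∞ (T% X) p) : ∀ᶠ q in 𝓝 p, MDiffAt (T% X) q := by
  have h1 : CMDiffAt 1 (T% X) p := hX.of_le (by simp)
  filter_upwards [(contMDiffAt_iff_contMDiffAt_nhds (by simp)).1 h1] with q hq
  exact hq.mdifferentiableAt one_ne_zero

theorem contMDiffAt_det {n : Type*} [Fintype n] [DecidableEq n] {G : M → Matrix n n ℝ} {p : M}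
    (hG : ∀ i j, CMDiffAt ∞ (fun q ↦ G q i j) p) : CMDiffAt ∞ (fun q ↦ (G q).det) p := by
  simp only [Matrix.det_apply']
  exact ContMDiffAt.sum fun σ _ ↦ contMDiffAt_const.mul (ContMDiffAt.prod fun i _ ↦ hG _ _)

variable [RiemannianBundle (fun x : M ↦ TangentSpace 𝓘(ℝ, E) x)]
  [IsContMDiffRiemannianBundle 𝓘(ℝ, E) ∞ E (fun x : M ↦ TangentSpace 𝓘(ℝ, E) x)]

theorem contMDiffAt_inner {X Y : Π x : M, TangentSpace 𝓘(ℝ, E) x} {p : M}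
    (hX : CMDiffAt ∞ (T% X) p) (hY : CMDiffAt ∞ (T% Y) p) :
    CMDiffAt ∞ (fun q ↦ (inner ℝ (X q) (Y q) : ℝ)) p :=
  ContMDiffAt.inner_bundle (F := E) (E := fun x : M ↦ TangentSpace 𝓘(ℝ, E) x)
    (b := fun q ↦ q) hX hY

theorem contMDiffAt_koszul {X Y Z : Π x : M, TangentSpace 𝓘(ℝ, E) x} {p : M}
    (hX : CMDiffAt ∞ (T% X) p) (hY : CMDiffAt ∞ (T% Y) p) (hZ : CMDiffAt ∞ (T% Z) p) :
    CMDiffAt ∞ (koszul X Y Z) p := by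
  unfold koszul
  refine contMDiffAt_const.mul ?_
  refine (((((contMDiffAt_mvfderiv_apply (contMDiffAt_inner hY hZ) hX).add
    (contMDiffAt_mvfderiv_apply (contMDiffAt_inner hX hZ) hY)).sub
    (contMDiffAt_mvfderiv_apply (contMDiffAt_inner hX hY) hZ)).add
    (contMDiffAt_inner (contMDiffAt_mlieBracket hX hY) hZ)).sub
    (contMDiffAt_inner (contMDiffAt_mlieBracket hX hZ) hY)).sub
    (contMDiffAt_inner (contMDiffAt_mlieBracket hY hZ) hX)

/-- A vector field is smooth if its inner products with smooth vector fields are. -/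
theorem contMDiffAt_of_inner {Z : Π x : M, TangentSpace 𝓘(ℝ, E) x} {p : M}
    (h : ∀ X : Π x : M, TangentSpace 𝓘(ℝ, E) x, CMDiffAt ∞ (T% X) p →
      CMDiffAt ∞ (fun q ↦ (inner ℝ (Z q) (X q) : ℝ)) p) : CMDiffAt ∞ (T% Z) p := by
  classical
  let t := trivializationAt E (fun x : M ↦ TangentSpace 𝓘(ℝ, E) x) p
  have hp : p ∈ t.baseSet := FiberBundle.mem_baseSet_trivializationAt E _ p
  let b := Module.Basis.ofVectorSpace ℝ E
  let e := t.localFrame b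
  have he : ∀ i, CMDiffAt ∞ (T% (e i)) p := fun i ↦ contMDiffAt_localFrame_of_mem ∞ _ b i hp
  rw [contMDiffAt_iff_localFrameCoeff b hp]
  let G : M → Matrix _ _ ℝ := fun q ↦ Matrix.of fun i j ↦ (inner ℝ (e i q) (e j q) : ℝ)
  let v : M → _ → ℝ := fun q i ↦ (inner ℝ (Z q) (e i q) : ℝ)
  have hG : ∀ i j, CMDiffAt ∞ (fun q ↦ G q i j) p := fun i j ↦ contMDiffAt_inner (he i) (he j)
  have hv : ∀ i, CMDiffAt ∞ (fun q ↦ v q i) p := fun i ↦ h _ (he i)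
  -- The Gram matrix of a frame is invertible, so Cramer's rule gives the frame coefficients of `Z`
  -- as quotients of smooth functions.
  have hdet : ∀ q ∈ t.baseSet, (G q).det ≠ 0 := by
    intro q hq hq0
    obtain ⟨c, hc, hGc⟩ := Matrix.exists_mulVec_eq_zero_iff.2 hq0
    have hli : LinearIndependent ℝ (fun i ↦ e i q) :=
      (t.isLocalFrameOn_localFrame_baseSet 𝓘(ℝ, E) 1 b).linearIndependent hq
    have h0 : ∑ j, c j • e j q = 0 := by
      rw [← inner_self_eq_zero (𝕜 := ℝ), sum_inner]
      refine Finset.sum_eq_zero fun i _ ↦ ?_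
      have : ∑ j, G q i j * c j = 0 := congrFun hGc i
      rw [inner_smul_left, inner_sum, ← mul_zero ((starRingEnd ℝ) (c i)), ← this]
      congr 1
      exact Finset.sum_congr rfl fun j _ ↦ by rw [inner_smul_right, mul_comm]; rfl
    exact hc (funext (Fintype.linearIndependent_iff.1 hli c h0))
  intro i
  have hnum : CMDiffAt ∞ (fun q ↦ (Matrix.cramer (G q) (v q)) i) p := by
    simp only [Matrix.cramer_apply]
    refine contMDiffAt_det fun j k ↦ ?_
    by_cases hk : k = i
    · subst hk; simpa using hv j
    · simpa [Matrix.updateCol_apply, hk] using hG j k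
  have hquot : CMDiffAt ∞ (fun q ↦ (Matrix.cramer (G q) (v q)) i / (G q).det) p :=
    hnum.div₀ (contMDiffAt_det hG) (hdet p hp)
  refine hquot.congr_of_eventuallyEq ?_
  filter_upwards [t.open_baseSet.mem_nhds hp] with q hq
  have hsum := t.eq_sum_localFrameCoeff_smul (I := 𝓘(ℝ, E)) (b := b) (s := Z) hq
  have hvq : (G q).mulVec (fun j ↦ t.localFrameCoeff 𝓘(ℝ, E) b j q (Z q)) = v q := by
    ext k
    simp only [Matrix.mulVec, dotProduct, G, v, Matrix.of_apply]
    conv_rhs => rw [hsum, sum_inner]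
    exact Finset.sum_congr rfl fun j _ ↦ by
      rw [real_inner_smul_left, mul_comm, real_inner_comm]
  rw [LinearMap.piApply_apply, eq_div_iff (hdet q hq), ← hvq, Matrix.cramer_eq_adjugate_mulVec, Matrix.mulVec_mulVec,
    Matrix.adjugate_mul, Matrix.smul_mulVec, Matrix.one_mulVec]
  simp [mul_comm]

/-- The Levi-Civita derivative of a smooth vector field along a smooth one is smooth. -/
theorem contMDiffAt_leviCivita {X Y : Π x : M, TangentSpace 𝓘(ℝ, E) x} {p : M}
    (hX : CMDiffAt ∞ (T% X) p) (hY : CMDiffAt ∞ (T% Y) p) :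
    CMDiffAt ∞ (T% (fun q ↦ leviCivita E M Y q (X q))) p := by
  refine contMDiffAt_of_inner fun Z hZ ↦ (contMDiffAt_koszul hX hY hZ).congr_of_eventuallyEq ?_
  filter_upwards [hX.eventually_mdiffAt, hY.eventually_mdiffAt, hZ.eventually_mdiffAt]
    with q h1 h2 h3 using inner_leviCivita h1 h2 h3

end Smoothness

/-! ### Coordinate vector fields, tensoriality, and brackets as commutators. -/

section VectorFields

variable {E : Type*} [NormedAddCommGroup E] [NormedSpace ℝ E] [FiniteDimensional ℝ E]
  {M : Type*} [TopologicalSpace M] [ChartedSpace E M] [IsManifold 𝓘(ℝ, E) ∞ M]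

theorem contMDiffAt_extend_smooth {p : M} (v : TangentSpace 𝓘(ℝ, E) p) :
    CMDiffAt ∞ (T% (extend E v : Π x : M, TangentSpace 𝓘(ℝ, E) x)) p :=
  contMDiffAt_extend ..

theorem eventually_contMDiffAt_extend {p : M} (v : TangentSpace 𝓘(ℝ, E) p) :
    ∀ᶠ q in 𝓝 p, CMDiffAt ∞ (T% (extend E v : Π x : M, TangentSpace 𝓘(ℝ, E) x)) q := by
  obtain ⟨s, hs, h⟩ := exists_contMDiffOn_extend (k := ∞) 𝓘(ℝ, E) E v
  filter_upwards [eventually_mem_nhds_iff.2 hs] with q hq using h.contMDiffAt hq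

theorem isManifold_minSmoothness : IsManifold 𝓘(ℝ, E) (minSmoothness ℝ 2) M := by
  rw [minSmoothness_of_isRCLikeNormedField]; infer_instance

/-- The constant vector field on a vector space. -/
def constField (c : E) : Π x : E, TangentSpace 𝓘(ℝ, E) x := fun _ ↦ c

/-- `extend` is constant in the tangent bundle trivialization at `p`, and that trivialization is the
derivative of the chart. -/
theorem extend_eq_mpullback {p q : M} (hq : q ∈ (chartAt E p).source)
    (v : TangentSpace 𝓘(ℝ, E) p) :
    extend E v q = mpullback 𝓘(ℝ, E) 𝓘(ℝ, E) (extChartAt 𝓘(ℝ, E) p)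
      (constField (trivializationAt E (TangentSpace 𝓘(ℝ, E)) p ⟨p, v⟩).2) q := by
  have hb : q ∈ (trivializationAt E (TangentSpace 𝓘(ℝ, E)) p).baseSet := by simpa using hq
  let e : TangentSpace 𝓘(ℝ, E) q ≃L[ℝ] TangentSpace 𝓘(ℝ, E) (extChartAt 𝓘(ℝ, E) p q) :=
    (trivializationAt E (TangentSpace 𝓘(ℝ, E)) p).continuousLinearEquivAt ℝ q hb
  have h1 : mfderiv% (extChartAt 𝓘(ℝ, E) p) q = e :=
    (TangentBundle.continuousLinearMapAt_trivializationAt hq).symm.trans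
      (Trivialization.coe_continuousLinearEquivAt_eq' _ hb).symm
  rw [mpullback_apply, h1, ContinuousLinearMap.inverse_equiv]
  rfl

/-- The vector fields `extend E v` are coordinate vector fields, so they commute. -/
theorem eventually_mlieBracket_extend {p : M} (v w : TangentSpace 𝓘(ℝ, E) p) :
    ∀ᶠ q in 𝓝 p, mlieBracket 𝓘(ℝ, E) (extend E v : Π x : M, TangentSpace 𝓘(ℝ, E) x)
      (extend E w) q = 0 := by
  have := isManifold_minSmoothness (E := E) (M := M)
  filter_upwards [(chartAt E p).open_source.mem_nhds (mem_chart_source E p)] with q hq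
  have hnear : ∀ u : TangentSpace 𝓘(ℝ, E) p, (extend E u : Π x : M, TangentSpace 𝓘(ℝ, E) x) =ᶠ[𝓝 q]
      mpullback 𝓘(ℝ, E) 𝓘(ℝ, E) (extChartAt 𝓘(ℝ, E) p)
        (constField (trivializationAt E (TangentSpace 𝓘(ℝ, E)) p ⟨p, u⟩).2) := by
    intro u
    filter_upwards [(chartAt E p).open_source.mem_nhds hq] with q' hq'
      using extend_eq_mpullback hq' u
  have hconst : ∀ c : E, MDiffAt (T% (constField c)) (extChartAt 𝓘(ℝ, E) p q) := by
    intro c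
    rw [mdifferentiableAt_section]
    simpa [constField] using! mdifferentiableAt_const
  rw [(hnear v).mlieBracket_vectorField_eq (hnear w), ← mpullback_mlieBracket (n := ∞) (hconst _)
    (hconst _) (contMDiffAt_extChartAt' hq)
    (by rw [minSmoothness_of_isRCLikeNormedField]; norm_cast)]
  have h0 : ∀ c d : E, mlieBracket 𝓘(ℝ, E) (constField c) (constField d) = 0 := by
    intro c d
    ext1 x
    rw [← mlieBracketWithin_univ, mlieBracketWithin_eq_lieBracketWithin]
    change lieBracketWithin ℝ (fun _ : E ↦ c) (fun _ ↦ d) Set.univ x = 0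
    simp [lieBracketWithin]
  rw [mpullback_apply, h0]
  exact map_zero _

theorem mvfderiv_congr {f g : M → ℝ} {p : M} (h : f =ᶠ[𝓝 p] g) : d% f p = d% g p := by
  rw [mvfderiv, mvfderiv, h.mfderiv_eq]; rfl

/-- Pointwise dependence of `C^∞`-linear operations on smooth vector fields. -/
theorem eq_of_smooth_tensorial {A : Type*} [AddCommGroup A] [Module ℝ A]
    {Φ : (Π x : M, TangentSpace 𝓘(ℝ, E) x) → A} {p : M}
    (hadd : ∀ X Y, CMDiffAt ∞ (T% X) p → CMDiffAt ∞ (T% Y) p → Φ (X + Y) = Φ X + Φ Y)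
    (hsmul : ∀ (f : M → ℝ) X, CMDiffAt ∞ f p → CMDiffAt ∞ (T% X) p → Φ (f • X) = f p • Φ X)
    {X Y : Π x : M, TangentSpace 𝓘(ℝ, E) x} (hX : CMDiffAt ∞ (T% X) p) (hY : CMDiffAt ∞ (T% Y) p)
    (hXY : X p = Y p) : Φ X = Φ Y := by
  classical
  have hlocal : ∀ {X Y : Π x : M, TangentSpace 𝓘(ℝ, E) x}, CMDiffAt ∞ (T% X) p →
      CMDiffAt ∞ (T% Y) p → (∀ᶠ q in 𝓝 p, X q = Y q) → Φ X = Φ Y := by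
    intro X Y hX hY hXY
    -- This indicator replaces a bump function: it equals `1` near `p`, hence is smooth at `p`, and
    -- smoothness elsewhere is not required. Moreover `ψ • X = ψ • Y` holds everywhere.
    let ψ (q : M) : ℝ := if X q = Y q then 1 else 0
    have hψp : ψ p = 1 := by simp [ψ, hXY.self_of_nhds]
    have heq : ψ • X = ψ • Y := by
      ext1 q
      by_cases hq : X q = Y q <;> simp [ψ, hq]
    have hψ : CMDiffAt ∞ ψ p :=
      (contMDiffAt_const (c := (1 : ℝ))).congr_of_eventuallyEq
        (hXY.mono fun q hq ↦ by simp [ψ, hq])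
    have h1 := hsmul ψ X hψ hX
    have h2 := hsmul ψ Y hψ hY
    rw [hψp, one_smul] at h1 h2
    rw [← h1, ← h2, heq]
  have hzero : Φ 0 = 0 := by
    have h0 : CMDiffAt ∞ (T% (0 : Π x : M, TangentSpace 𝓘(ℝ, E) x)) p :=
      (contMDiff_zeroSection ℝ (fun x : M ↦ TangentSpace 𝓘(ℝ, E) x)).contMDiffAt
    simpa using hsmul (fun _ ↦ 0) 0 contMDiffAt_const h0
  have hsum : ∀ {ι : Type _} (s : Finset ι) (σ : ι → Π x : M, TangentSpace 𝓘(ℝ, E) x),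
      (∀ i, CMDiffAt ∞ (T% (σ i)) p) → Φ (fun q ↦ ∑ i ∈ s, σ i q) = ∑ i ∈ s, Φ (σ i) := by
    intro ι s σ hσ
    induction s using Finset.induction_on with
    | empty => simpa using! hzero
    | insert a s ha ih =>
      simp only [Finset.sum_insert ha, ← ih]
      exact hadd _ _ (hσ a) (.sum_section fun i _ ↦ hσ i)
  let t := trivializationAt E (fun x : M ↦ TangentSpace 𝓘(ℝ, E) x) p
  have hp : p ∈ t.baseSet := FiberBundle.mem_baseSet_trivializationAt E _ p
  let b := Module.Basis.ofVectorSpace ℝ E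
  let s := t.localFrame b
  let c := t.localFrameCoeff 𝓘(ℝ, E) b
  have hs (i) : CMDiffAt ∞ (T% (s i)) p := contMDiffAt_localFrame_of_mem ∞ _ b i hp
  have hc {X : Π x : M, TangentSpace 𝓘(ℝ, E) x} (hX : CMDiffAt ∞ (T% X) p) (i) :
      CMDiffAt ∞ (LinearMap.piApply (c i) X) p := contMDiffAt_localFrameCoeff b hp hX i
  have hexp {X : Π x : M, TangentSpace 𝓘(ℝ, E) x} (hX : CMDiffAt ∞ (T% X) p) :
      Φ X = ∑ i, c i p (X p) • Φ (s i) := by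
    rw [hlocal hX (.sum_section fun i _ ↦ (hc hX i).smul_section (hs i))
      (t.eventually_eq_localFrame_sum_coeff_smul b hp)]
    refine (hsum Finset.univ (fun i ↦ LinearMap.piApply (c i) X • s i)
      fun i ↦ (hc hX i).smul_section (hs i)).trans ?_
    exact Finset.sum_congr rfl fun i _ ↦ hsmul _ _ (hc hX i) (hs i)
  rw [hexp hX, hexp hY, hXY]

theorem _root_.ContMDiffAt.mdiffAt_infty {X : Π x : M, TangentSpace 𝓘(ℝ, E) x} {p : M}
    (hX : CMDiffAt ∞ (T% X) p) : MDiffAt (T% X) p := hX.mdifferentiableAt (by simp)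

theorem eventually_mdiffAt {f : M → ℝ} {p : M} (hf : CMDiffAt ∞ f p) :
    ∀ᶠ q in 𝓝 p, MDiffAt f q := by
  have h1 : CMDiffAt 1 f p := hf.of_le (by simp)
  filter_upwards [(contMDiffAt_iff_contMDiffAt_nhds (by simp)).1 h1] with q hq
  exact hq.mdifferentiableAt one_ne_zero

/-- The Lie bracket acts on functions as the commutator of derivations. -/
theorem mvfderiv_mlieBracket {X Y : Π x : M, TangentSpace 𝓘(ℝ, E) x} {f : M → ℝ} {p : M}
    (hX : CMDiffAt ∞ (T% X) p) (hY : CMDiffAt ∞ (T% Y) p) (hf : CMDiffAt ∞ f p) :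
    d% f p (mlieBracket 𝓘(ℝ, E) X Y p) =
      d% (fun q ↦ d% f q (Y q)) p (X p) - d% (fun q ↦ d% f q (X q)) p (Y p) := by
  have := isManifold_minSmoothness (E := E) (M := M)
  have : IsManifold 𝓘(ℝ, E) (minSmoothness ℝ 3) M := by
    rw [minSmoothness_of_isRCLikeNormedField]; infer_instance
  -- The identity will be read off as the coefficient of a nonzero vector `z` in the Jacobi identity
  -- for `X`, `Y`, `f Z`, after subtracting `f` times the one for `X`, `Y`, `Z`.
  by_cases hz : ∃ z : TangentSpace 𝓘(ℝ, E) p, z ≠ 0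
  swap
  · push Not at hz
    rw [hz (X p), hz (Y p), hz (mlieBracket 𝓘(ℝ, E) X Y p)]
    simp
  obtain ⟨z, hz⟩ := hz
  let Z : Π x : M, TangentSpace 𝓘(ℝ, E) x := extend E z
  have hZ : CMDiffAt ∞ (T% Z) p := contMDiffAt_extend_smooth z
  have hZp : Z p = z := extend_apply_self _ z
  have hf1 : MDiffAt f p := hf.mdifferentiableAt (by simp)
  have expand : ∀ {X Y : Π x : M, TangentSpace 𝓘(ℝ, E) x}, CMDiffAt ∞ (T% X) p →
      CMDiffAt ∞ (T% Y) p → mlieBracket 𝓘(ℝ, E) X (mlieBracket 𝓘(ℝ, E) Y (f • Z)) p =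
        d% (fun q ↦ d% f q (Y q)) p (X p) • z + d% f p (Y p) • mlieBracket 𝓘(ℝ, E) X Z p
        + (d% f p (X p) • mlieBracket 𝓘(ℝ, E) Y Z p
          + f p • mlieBracket 𝓘(ℝ, E) X (mlieBracket 𝓘(ℝ, E) Y Z) p) := by
    intro X Y hX hY
    have h1 : mlieBracket 𝓘(ℝ, E) Y (f • Z) =ᶠ[𝓝 p]
        (fun q ↦ d% f q (Y q)) • Z + f • mlieBracket 𝓘(ℝ, E) Y Z := by
      filter_upwards [eventually_mdiffAt hf, hZ.eventually_mdiffAt] with q h1 h2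
      exact mlieBracket_smul_right h1 h2
    have hd := contMDiffAt_mvfderiv_apply hf hY
    have hB := contMDiffAt_mlieBracket hY hZ
    have e0 : X =ᶠ[𝓝 p] X := Filter.EventuallyEq.rfl
    rw [e0.mlieBracket_vectorField_eq h1,
      mlieBracket_add_right (hd.smul_section hZ).mdiffAt_infty (hf.smul_section hB).mdiffAt_infty,
      mlieBracket_smul_right (hd.mdifferentiableAt (by simp)) hZ.mdiffAt_infty,
      mlieBracket_smul_right hf1 hB.mdiffAt_infty, hZp]
  have hsm : ∀ {X : Π x : M, TangentSpace 𝓘(ℝ, E) x}, CMDiffAt ∞ (T% X) p →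
      CMDiffAt (minSmoothness ℝ 2) (T% X) p := fun hX ↦ by
    rw [minSmoothness_of_isRCLikeNormedField]; exact hX.of_le (by norm_cast)
  have jac := leibniz_identity_mlieBracket_apply (hsm hX) (hsm hY) (hsm (hf.smul_section hZ))
  have jac' := leibniz_identity_mlieBracket_apply (hsm hX) (hsm hY) (hsm hZ)
  rw [expand hX hY, expand hY hX, mlieBracket_smul_right hf1 hZ.mdiffAt_infty, hZp, jac'] at jac
  have h0 : (d% (fun q ↦ d% f q (Y q)) p (X p) - d% (fun q ↦ d% f q (X q)) p (Y p)
      - d% f p (mlieBracket 𝓘(ℝ, E) X Y p)) • z = 0 := by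
    rw [← sub_eq_zero] at jac
    rw [← jac]
    module
  have := (smul_eq_zero.1 h0).resolve_right hz
  linarith

end VectorFields

/-! ### Tensoriality and symmetries of the Riemann curvature tensor. -/

section CurvatureTensor

variable {E : Type*} [NormedAddCommGroup E] [NormedSpace ℝ E] [FiniteDimensional ℝ E]
  {M : Type*} [TopologicalSpace M] [ChartedSpace E M] [IsManifold 𝓘(ℝ, E) ∞ M]
  [RiemannianBundle (fun x : M ↦ TangentSpace 𝓘(ℝ, E) x)]
  [IsContMDiffRiemannianBundle 𝓘(ℝ, E) ∞ E (fun x : M ↦ TangentSpace 𝓘(ℝ, E) x)]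

variable {X X' Y Y' Z Z' W : Π x : M, TangentSpace 𝓘(ℝ, E) x} {f : M → ℝ} {p : M}

/-- The vector field `∇_X Y`. -/
noncomputable abbrev nabla (X Y : Π x : M, TangentSpace 𝓘(ℝ, E) x) :
    Π x : M, TangentSpace 𝓘(ℝ, E) x :=
  fun q ↦ leviCivita E M Y q (X q)

theorem leviCivita_congr (hY : MDiffAt (T% Y) p) (hY' : MDiffAt (T% Y') p) (h : Y =ᶠ[𝓝 p] Y') :
    leviCivita E M Y p = leviCivita E M Y' p :=
  (leviCivita E M).isCovariantDerivativeOnUniv.congr_of_eventuallyEq hY hY' Filter.univ_mem h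

theorem leviCivita_add (hY : MDiffAt (T% Y) p) (hY' : MDiffAt (T% Y') p)
    (x : TangentSpace 𝓘(ℝ, E) p) :
    leviCivita E M (Y + Y') p x = leviCivita E M Y p x + leviCivita E M Y' p x := by
  rw [(leviCivita E M).isCovariantDerivativeOnUniv.add hY hY' trivial]; rfl

theorem leviCivita_smul (hf : MDiffAt f p) (hY : MDiffAt (T% Y) p)
    (x : TangentSpace 𝓘(ℝ, E) p) :
    leviCivita E M (f • Y) p x = f p • leviCivita E M Y p x + d% f p x • Y p := by
  rw [(leviCivita E M).isCovariantDerivativeOnUniv.leibniz hY hf trivial]; rfl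

theorem leviCivita_const_smul (c : ℝ) (hY : MDiffAt (T% Y) p) (x : TangentSpace 𝓘(ℝ, E) p) :
    leviCivita E M (c • Y) p x = c • leviCivita E M Y p x := by
  have := leviCivita_smul (f := fun _ ↦ c) mdifferentiableAt_const hY x
  rw [mvfderiv_const] at this
  simpa using! this

theorem leviCivita_neg (hY : MDiffAt (T% Y) p) (x : TangentSpace 𝓘(ℝ, E) p) :
    leviCivita E M (-Y) p x = - leviCivita E M Y p x := by
  simpa using leviCivita_const_smul (-1) hY x

theorem leviCivita_sub (hY : MDiffAt (T% Y) p) (hY' : MDiffAt (T% Y') p)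
    (x : TangentSpace 𝓘(ℝ, E) p) :
    leviCivita E M (Y - Y') p x = leviCivita E M Y p x - leviCivita E M Y' p x := by
  rw [sub_eq_add_neg, leviCivita_add hY (mdifferentiableAt_neg_section hY'), leviCivita_neg hY',
    sub_eq_add_neg]

theorem nabla_sub_nabla (hX : MDiffAt (T% X) p) (hY : MDiffAt (T% Y) p) :
    nabla X Y p - nabla Y X p = mlieBracket 𝓘(ℝ, E) X Y p :=
  (CovariantDerivative.torsion_eq_zero_iff _).1 (torsion_leviCivita (E := E) (M := M)) hX hY

theorem curvatureField_def : curvatureField X Y Z p =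
    nabla X (nabla Y Z) p - nabla Y (nabla X Z) p - nabla (mlieBracket 𝓘(ℝ, E) X Y) Z p := rfl

theorem curvatureField_swap : curvatureField X Y Z p = - curvatureField Y X Z p := by
  rw [curvatureField, curvatureField, mlieBracket_swap_apply (V := X), map_neg]
  abel

theorem curvatureField_add_left (hX : CMDiffAt ∞ (T% X) p) (hX' : CMDiffAt ∞ (T% X') p)
    (hZ : CMDiffAt ∞ (T% Z) p) :
    curvatureField (X + X') Y Z p = curvatureField X Y Z p + curvatureField X' Y Z p := by
  have h : nabla (X + X') Z = nabla X Z + nabla X' Z := by ext1 q; simp [nabla]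
  simp only [curvatureField_def, h]
  simp only [nabla, leviCivita_add (contMDiffAt_leviCivita hX hZ).mdiffAt_infty
    (contMDiffAt_leviCivita hX' hZ).mdiffAt_infty,
    mlieBracket_add_left hX.mdiffAt_infty hX'.mdiffAt_infty, Pi.add_apply, map_add]
  abel

theorem curvatureField_smul_left (hf : CMDiffAt ∞ f p) (hX : CMDiffAt ∞ (T% X) p)
    (hZ : CMDiffAt ∞ (T% Z) p) :
    curvatureField (f • X) Y Z p = f p • curvatureField X Y Z p := by
  have hf' : MDiffAt f p := hf.mdifferentiableAt (by simp)
  have h : nabla (f • X) Z = f • nabla X Z := by ext1 q; simp [nabla]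
  simp only [curvatureField_def, h]
  simp only [nabla, leviCivita_smul hf' (contMDiffAt_leviCivita hX hZ).mdiffAt_infty,
    mlieBracket_smul_left hf' hX.mdiffAt_infty, Pi.smul_apply', map_add, map_smul]
  module

theorem curvatureField_add_right (hX : CMDiffAt ∞ (T% X) p) (hY : CMDiffAt ∞ (T% Y) p)
    (hZ : CMDiffAt ∞ (T% Z) p) (hZ' : CMDiffAt ∞ (T% Z') p) :
    curvatureField X Y (Z + Z') p = curvatureField X Y Z p + curvatureField X Y Z' p := by
  have h : ∀ {X}, CMDiffAt ∞ (T% X) p →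
      ∀ x, leviCivita E M (nabla X (Z + Z')) p x =
        leviCivita E M (nabla X Z) p x + leviCivita E M (nabla X Z') p x := by
    intro X hX x
    have h1 := contMDiffAt_leviCivita hX hZ
    have h2 := contMDiffAt_leviCivita hX hZ'
    rw [← leviCivita_add h1.mdiffAt_infty h2.mdiffAt_infty, leviCivita_congr
      (contMDiffAt_leviCivita hX (hZ.add_section hZ')).mdiffAt_infty
      (h1.add_section h2).mdiffAt_infty]
    filter_upwards [hZ.eventually_mdiffAt, hZ'.eventually_mdiffAt] with q h1 h2
    exact leviCivita_add h1 h2 _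
  simp only [curvatureField_def]
  simp only [nabla] at h ⊢
  rw [h hX, h hY, leviCivita_add hZ.mdiffAt_infty hZ'.mdiffAt_infty]
  abel

/-- The first derivatives of `f` cancel in the commutator, and the second derivatives cancel against
the bracket term by `mvfderiv_mlieBracket`. -/
theorem curvatureField_smul_right (hf : CMDiffAt ∞ f p) (hX : CMDiffAt ∞ (T% X) p)
    (hY : CMDiffAt ∞ (T% Y) p) (hZ : CMDiffAt ∞ (T% Z) p) :
    curvatureField X Y (f • Z) p = f p • curvatureField X Y Z p := by
  have hf' : MDiffAt f p := hf.mdifferentiableAt (by simp)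
  have h : ∀ {X}, CMDiffAt ∞ (T% X) p →
      ∀ x, leviCivita E M (nabla X (f • Z)) p x =
        f p • leviCivita E M (nabla X Z) p x + d% f p x • nabla X Z p
        + (d% f p (X p) • leviCivita E M Z p x + d% (fun q ↦ d% f q (X q)) p x • Z p) := by
    intro X hX x
    have h1 := contMDiffAt_leviCivita hX hZ
    have h2 := contMDiffAt_mvfderiv_apply hf hX
    rw [← leviCivita_smul hf' h1.mdiffAt_infty, ← leviCivita_smul (f := fun q ↦ d% f q (X q))
      (h2.mdifferentiableAt (by simp)) hZ.mdiffAt_infty, ← leviCivita_add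
      (hf.smul_section h1).mdiffAt_infty (h2.smul_section hZ).mdiffAt_infty, leviCivita_congr
      (contMDiffAt_leviCivita hX (hf.smul_section hZ)).mdiffAt_infty
      ((hf.smul_section h1).add_section (h2.smul_section hZ)).mdiffAt_infty]
    filter_upwards [hZ.eventually_mdiffAt, eventually_mdiffAt hf] with q h1 h2
    exact leviCivita_smul h2 h1 _
  simp only [curvatureField_def]
  simp only [nabla] at h ⊢
  rw [h hX, h hY, leviCivita_smul hf' hZ.mdiffAt_infty, mvfderiv_mlieBracket hX hY hf]
  module

/-- The curvature of smooth vector fields depends only on their values at the point. -/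
theorem curvatureField_eq (hX : CMDiffAt ∞ (T% X) p) (hX' : CMDiffAt ∞ (T% X') p)
    (hY : CMDiffAt ∞ (T% Y) p) (hY' : CMDiffAt ∞ (T% Y') p)
    (hZ : CMDiffAt ∞ (T% Z) p) (hZ' : CMDiffAt ∞ (T% Z') p)
    (h₁ : X p = X' p) (h₂ : Y p = Y' p) (h₃ : Z p = Z' p) :
    curvatureField X Y Z p = curvatureField X' Y' Z' p := by
  have e1 : curvatureField X Y Z p = curvatureField X' Y Z p :=
    eq_of_smooth_tensorial (Φ := fun X ↦ curvatureField X Y Z p)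
      (fun _ _ h h' ↦ curvatureField_add_left h h' hZ)
      (fun _ _ h h' ↦ curvatureField_smul_left h h' hZ) hX hX' h₁
  have e2 : curvatureField Y X' Z p = curvatureField Y' X' Z p :=
    eq_of_smooth_tensorial (Φ := fun Y ↦ curvatureField Y X' Z p)
      (fun _ _ h h' ↦ curvatureField_add_left h h' hZ)
      (fun _ _ h h' ↦ curvatureField_smul_left h h' hZ) hY hY' h₂
  have e3 : curvatureField X' Y' Z p = curvatureField X' Y' Z' p :=
    eq_of_smooth_tensorial (Φ := fun Z ↦ curvatureField X' Y' Z p)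
      (fun _ _ h h' ↦ curvatureField_add_right hX' hY' h h')
      (fun _ _ h h' ↦ curvatureField_smul_right h hX' hY' h') hZ hZ' h₃
  rw [e1, curvatureField_swap, e2, ← curvatureField_swap, e3]

theorem inner_curvatureField (hX : CMDiffAt ∞ (T% X) p) (hY : CMDiffAt ∞ (T% Y) p)
    (hZ : CMDiffAt ∞ (T% Z) p) (u : TangentSpace 𝓘(ℝ, E) p) :
    inner ℝ (curvatureField X Y Z p) u = curvatureTensor p (X p) (Y p) (Z p) u := by
  rw [curvatureTensor, curvatureField_eq hX (contMDiffAt_extend_smooth (X p)) hY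
    (contMDiffAt_extend_smooth (Y p)) hZ (contMDiffAt_extend_smooth (Z p))] <;> simp

/-- Metric compatibility expands both orders of differentiation of `⟨Z, W⟩`; their difference is the
derivative along `[X, Y]`, and the mixed terms cancel. -/
theorem inner_curvatureField_swap (hX : CMDiffAt ∞ (T% X) p) (hY : CMDiffAt ∞ (T% Y) p)
    (hZ : CMDiffAt ∞ (T% Z) p) (hW : CMDiffAt ∞ (T% W) p) :
    (inner ℝ (curvatureField X Y Z p) (W p) : ℝ) = - inner ℝ (Z p) (curvatureField X Y W p) := by
  have hB := contMDiffAt_mlieBracket hX hY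
  have hg := contMDiffAt_inner hZ hW
  have hd : ∀ {X Y}, CMDiffAt ∞ (T% X) p → CMDiffAt ∞ (T% Y) p →
      d% (fun q ↦ d% (fun q ↦ (inner ℝ (Z q) (W q) : ℝ)) q (Y q)) p (X p) =
        inner ℝ (nabla X (nabla Y Z) p) (W p) + inner ℝ (nabla Y Z p) (nabla X W p)
        + (inner ℝ (nabla X Z p) (nabla Y W p) + inner ℝ (Z p) (nabla X (nabla Y W) p)) := by
    intro X Y hX hY
    have h1 := contMDiffAt_leviCivita hY hZ
    have h2 := contMDiffAt_leviCivita hY hW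
    have e : (fun q ↦ d% (fun q ↦ (inner ℝ (Z q) (W q) : ℝ)) q (Y q)) =ᶠ[𝓝 p]
        fun q ↦ inner ℝ (nabla Y Z q) (W q) + inner ℝ (Z q) (nabla Y W q) := by
      filter_upwards [hY.eventually_mdiffAt, hZ.eventually_mdiffAt, hW.eventually_mdiffAt]
        with q h1 h2 h3 using mvfderiv_inner_leviCivita h1 h2 h3
    rw [mvfderiv_congr e, mvfderiv_fun_add (mdiffAt_inner h1.mdiffAt_infty hW.mdiffAt_infty)
      (mdiffAt_inner hZ.mdiffAt_infty h2.mdiffAt_infty), add_apply,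
      mvfderiv_inner_leviCivita hX.mdiffAt_infty h1.mdiffAt_infty hW.mdiffAt_infty,
      mvfderiv_inner_leviCivita hX.mdiffAt_infty hZ.mdiffAt_infty h2.mdiffAt_infty]
  have h := mvfderiv_mlieBracket hX hY hg
  rw [hd hX hY, hd hY hX, mvfderiv_inner_leviCivita hB.mdiffAt_infty hZ.mdiffAt_infty
    hW.mdiffAt_infty] at h
  simp only [curvatureField_def, inner_sub_left, inner_sub_right]
  linarith

/-- For commuting fields, torsion-freeness gives `∇_X Y = ∇_Y X` near `p`, and the second
derivatives cancel in pairs. Commuting fields suffice because the extensions defining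
`curvatureTensor` commute. -/
theorem curvatureField_bianchi (hX : CMDiffAt ∞ (T% X) p) (hY : CMDiffAt ∞ (T% Y) p)
    (hZ : CMDiffAt ∞ (T% Z) p) (hXY : ∀ᶠ q in 𝓝 p, mlieBracket 𝓘(ℝ, E) X Y q = 0)
    (hYZ : ∀ᶠ q in 𝓝 p, mlieBracket 𝓘(ℝ, E) Y Z q = 0)
    (hZX : ∀ᶠ q in 𝓝 p, mlieBracket 𝓘(ℝ, E) Z X q = 0) :
    curvatureField X Y Z p + curvatureField Y Z X p + curvatureField Z X Y p = 0 := by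
  have comm : ∀ {X Y}, CMDiffAt ∞ (T% X) p → CMDiffAt ∞ (T% Y) p →
      (∀ᶠ q in 𝓝 p, mlieBracket 𝓘(ℝ, E) X Y q = 0) →
      leviCivita E M (nabla X Y) p = leviCivita E M (nabla Y X) p := by
    intro X Y hX hY h
    refine leviCivita_congr (contMDiffAt_leviCivita hX hY).mdiffAt_infty
      (contMDiffAt_leviCivita hY hX).mdiffAt_infty ?_
    filter_upwards [h, hX.eventually_mdiffAt, hY.eventually_mdiffAt] with q hq h1 h2
    have := nabla_sub_nabla h1 h2
    rwa [hq, sub_eq_zero] at this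
  have h1 := comm hX hY hXY
  have h2 := comm hY hZ hYZ
  have h3 := comm hZ hX hZX
  rw [curvatureField, curvatureField, curvatureField, hXY.self_of_nhds, hYZ.self_of_nhds,
    hZX.self_of_nhds, h1, h2, h3]
  simp only [map_zero]
  abel

theorem isCurvatureLike_curvatureTensor (p : M) :
    IsCurvatureLike (curvatureTensor p : TangentSpace 𝓘(ℝ, E) p → _ → _ → _ → ℝ) := by
  have hs := fun v : TangentSpace 𝓘(ℝ, E) p ↦ contMDiffAt_extend_smooth v
  refine ⟨fun x x' y z u ↦ ?_, fun c x y z u ↦ ?_, fun x y z u u' ↦ inner_add_right _ _ _,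
    fun c x y z u ↦ real_inner_smul_right _ _ _, fun x y z u ↦ ?_, fun x y z u ↦ ?_,
    fun x y z u ↦ ?_⟩
  · rw [curvatureTensor, curvatureTensor, curvatureTensor, ← inner_add_left,
      ← curvatureField_add_left (hs x) (hs x') (hs z),
      curvatureField_eq (hs (x + x')) ((hs x).add_section (hs x')) (hs y) (hs y) (hs z) (hs z)] <;>
    simp
  · have hc : CMDiffAt ∞ (fun _ : M ↦ c) p := contMDiffAt_const
    rw [curvatureTensor, curvatureTensor, ← real_inner_smul_left,
      ← curvatureField_smul_left (f := fun _ ↦ c) hc (hs x) (hs z),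
      curvatureField_eq (hs (c • x)) (hc.smul_section (hs x)) (hs y) (hs y) (hs z) (hs z)] <;>
    simp
  · rw [curvatureTensor, curvatureTensor, curvatureField_swap, inner_neg_left]
  · have := inner_curvatureField_swap (hs x) (hs y) (hs z) (hs u)
    rw [extend_apply_self, extend_apply_self] at this
    rw [curvatureTensor, curvatureTensor, this, real_inner_comm]
  · rw [curvatureTensor, curvatureTensor, curvatureTensor, ← inner_add_left, ← inner_add_left,
      curvatureField_bianchi (hs x) (hs y) (hs z) (eventually_mlieBracket_extend x y)
        (eventually_mlieBracket_extend y z) (eventually_mlieBracket_extend z x), inner_zero_left]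

end CurvatureTensor

/-! ### The second Bianchi identity and the tensor `∇J`. -/

section SecondBianchi

variable {E : Type*} [NormedAddCommGroup E] [NormedSpace ℝ E] [FiniteDimensional ℝ E]
  {M : Type*} [TopologicalSpace M] [ChartedSpace E M] [IsManifold 𝓘(ℝ, E) ∞ M]
  [RiemannianBundle (fun x : M ↦ TangentSpace 𝓘(ℝ, E) x)]
  [IsContMDiffRiemannianBundle 𝓘(ℝ, E) ∞ E (fun x : M ↦ TangentSpace 𝓘(ℝ, E) x)]

variable {X Y Z W : Π x : M, TangentSpace 𝓘(ℝ, E) x} {p : M}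

theorem mvfderiv_inner_apply (hY : MDiffAt (T% Y) p) (hZ : MDiffAt (T% Z) p)
    (x : TangentSpace 𝓘(ℝ, E) p) :
    d% (fun q ↦ (inner ℝ (Y q) (Z q) : ℝ)) p x =
      inner ℝ (leviCivita E M Y p x) (Z p) + inner ℝ (Y p) (leviCivita E M Z p x) := by
  simpa using mvfderiv_inner_leviCivita (mdiffAt_extend x) hY hZ

/-- The second Bianchi identity for commuting vector fields `X`, `Y`, `Z`. -/
theorem second_bianchi (hX : CMDiffAt ∞ (T% X) p) (hY : CMDiffAt ∞ (T% Y) p)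
    (hZ : CMDiffAt ∞ (T% Z) p) (hW : CMDiffAt ∞ (T% W) p)
    (hXY : ∀ᶠ q in 𝓝 p, mlieBracket 𝓘(ℝ, E) X Y q = 0)
    (hYZ : ∀ᶠ q in 𝓝 p, mlieBracket 𝓘(ℝ, E) Y Z q = 0)
    (hZX : ∀ᶠ q in 𝓝 p, mlieBracket 𝓘(ℝ, E) Z X q = 0) :
    (leviCivita E M (curvatureField Y Z W) p (X p) - curvatureField Y Z (nabla X W) p)
    + (leviCivita E M (curvatureField Z X W) p (Y p) - curvatureField Z X (nabla Y W) p)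
    + (leviCivita E M (curvatureField X Y W) p (Z p) - curvatureField X Y (nabla Z W) p) = 0 := by
  have hd : ∀ {Y Z}, CMDiffAt ∞ (T% Y) p → CMDiffAt ∞ (T% Z) p →
      (∀ᶠ q in 𝓝 p, mlieBracket 𝓘(ℝ, E) Y Z q = 0) → ∀ x,
      leviCivita E M (curvatureField Y Z W) p x = leviCivita E M (nabla Y (nabla Z W)) p x
        - leviCivita E M (nabla Z (nabla Y W)) p x := by
    intro Y Z hY hZ hYZ x
    have h1 := contMDiffAt_leviCivita hY (contMDiffAt_leviCivita hZ hW)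
    have h2 := contMDiffAt_leviCivita hZ (contMDiffAt_leviCivita hY hW)
    have h12 := (h1.sub_section h2).mdiffAt_infty
    have he : curvatureField Y Z W =ᶠ[𝓝 p] nabla Y (nabla Z W) - nabla Z (nabla Y W) := by
      filter_upwards [hYZ] with q hq
      rw [curvatureField, hq, map_zero, sub_zero]
      rfl
    have h3 : MDiffAt (T% (curvatureField Y Z W)) p :=
      h12.congr_of_eventuallyEq (he.mono fun q hq ↦ by simp [hq])
    rw [← leviCivita_sub h1.mdiffAt_infty h2.mdiffAt_infty, leviCivita_congr h3 h12 he]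
  -- With vanishing brackets each curvature operator is a commutator of covariant derivatives, and
  -- the sum is the Jacobi identity for `∇_X`, `∇_Y`, `∇_Z`.
  rw [hd hY hZ hYZ, hd hZ hX hZX, hd hX hY hXY, curvatureField, curvatureField, curvatureField,
    hXY.self_of_nhds, hYZ.self_of_nhds, hZX.self_of_nhds]
  simp only [map_zero]
  abel

theorem mdiffAt_inner_smul (hY : MDiffAt (T% Y) p) (hZ : MDiffAt (T% Z) p)
    (hW : MDiffAt (T% W) p) :
    MDiffAt (T% ((fun q ↦ (inner ℝ (Y q) (Z q) : ℝ)) • W)) p :=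
  (mdiffAt_inner hY hZ).smul_section hW

theorem leviCivita_inner_smul (hY : MDiffAt (T% Y) p) (hZ : MDiffAt (T% Z) p)
    (hW : MDiffAt (T% W) p) (x : TangentSpace 𝓘(ℝ, E) p) :
    leviCivita E M ((fun q ↦ (inner ℝ (Y q) (Z q) : ℝ)) • W) p x =
      (inner ℝ (Y p) (Z p) : ℝ) • leviCivita E M W p x
      + (inner ℝ (leviCivita E M Y p x) (Z p) + inner ℝ (Y p) (leviCivita E M Z p x) : ℝ) • W p := by
  rw [leviCivita_smul (mdiffAt_inner hY hZ) hW, mvfderiv_inner_apply hY hZ]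

namespace AlmostHermitianStructure

variable (A : AlmostHermitianStructure E M)

theorem isOrthogonalComplex (p : M) : IsOrthogonalComplex (A.J p) := ⟨A.J_J p, A.inner_J_J p⟩

/-- The vector field `JY`. -/
noncomputable abbrev map (Y : Π x : M, TangentSpace 𝓘(ℝ, E) x) :
    Π x : M, TangentSpace 𝓘(ℝ, E) x :=
  fun q ↦ A.J q (Y q)

theorem contMDiffAt_map (hY : CMDiffAt ∞ (T% Y) p) : CMDiffAt ∞ (T% (A.map Y)) p :=
  ContMDiffAt.clm_bundle_apply (A.contMDiff p) hY

theorem mdiffAt_map (hY : MDiffAt (T% Y) p) : MDiffAt (T% (A.map Y)) p :=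
  MDifferentiableAt.clm_bundle_apply ((A.contMDiff p).mdifferentiableAt (by simp)) hY

/-- The tensor `(∇_x J) y`. -/
noncomputable def nablaJ (p : M) (x y : TangentSpace 𝓘(ℝ, E) p) : TangentSpace 𝓘(ℝ, E) p :=
  leviCivita E M (A.map (extend E y)) p x - A.J p (leviCivita E M (extend E y) p x)

/-- In `∇_x (JY) - J ∇_x Y` the Leibniz terms in `df` cancel, so it depends only on `Y p`; the
particular extension in `nablaJ` is immaterial. -/
theorem leviCivita_map (hY : MDiffAt (T% Y) p) (x : TangentSpace 𝓘(ℝ, E) p) :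
    leviCivita E M (A.map Y) p x = A.nablaJ p x (Y p) + A.J p (leviCivita E M Y p x) := by
  have ht : TensorialAt 𝓘(ℝ, E) E (fun Y ↦ leviCivita E M (A.map Y) p x
      - A.J p (leviCivita E M Y p x)) p :=
    { smul := by
        intro f Y hf hY
        have h : A.map (f • Y) = f • A.map Y := funext fun q ↦ map_smul (A.J q) _ _
        simp only [h]
        rw [leviCivita_smul hf (A.mdiffAt_map hY), leviCivita_smul hf hY, map_add, map_smul,
          map_smul]
        module
      add := by
        intro Y Y' hY hY'
        have h : A.map (Y + Y') = A.map Y + A.map Y' := funext fun q ↦ map_add (A.J q) _ _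
        simp only [h]
        rw [leviCivita_add (A.mdiffAt_map hY) (A.mdiffAt_map hY'), leviCivita_add hY hY', map_add]
        abel }
  have := ht.pointwise hY (mdiffAt_extend (Y p)) (by simp)
  rw [sub_eq_iff_eq_add] at this
  exact this

/-- Skewness comes from differentiating `⟨a, Jb⟩ + ⟨Ja, b⟩ = 0`, and compatibility with `J` from
differentiating `J² = -1`. -/
theorem isNablaComplex (p : M) : IsNablaComplex (A.J p)
    (fun x a b ↦ (inner ℝ a (A.nablaJ p x b) : ℝ)) := by
  have hm := fun v : TangentSpace 𝓘(ℝ, E) p ↦ mdiffAt_extend v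
  have heq : ∀ x y (Y : Π x : M, TangentSpace 𝓘(ℝ, E) x), MDiffAt (T% Y) p → Y p = y →
      A.nablaJ p x y = leviCivita E M (A.map Y) p x - A.J p (leviCivita E M Y p x) := by
    intro x y Y hY h
    rw [A.leviCivita_map hY, h]; abel
  refine ⟨fun x x' a b ↦ ?_, fun x a b b' ↦ ?_, fun c x a b ↦ ?_, fun x a b ↦ ?_,
    fun x a b ↦ ?_⟩
  · simp only [nablaJ, map_add, ← inner_add_right]
    congr 1
    abel
  · rw [heq x (b + b') (extend E b + extend E b') (mdifferentiableAt_add_section (hm b) (hm b'))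
      (by simp)]
    have h : A.map (extend E b + extend E b') = A.map (extend E b) + A.map (extend E b') :=
      funext fun q ↦ map_add (A.J q) _ _
    rw [h, leviCivita_add (A.mdiffAt_map (hm b)) (A.mdiffAt_map (hm b')),
      leviCivita_add (hm b) (hm b'), map_add, ← inner_add_right, nablaJ, nablaJ]
    congr 1
    abel
  · have hc : MDiffAt (T% (c • (extend E b : Π x : M, TangentSpace 𝓘(ℝ, E) x))) p :=
      (mdifferentiableAt_const (c := c)).smul_section (hm b)
    have h : A.map (c • (extend E b : Π x : M, TangentSpace 𝓘(ℝ, E) x)) = c • A.map (extend E b) :=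
      funext fun q ↦ map_smul (A.J q) _ _
    rw [heq x (c • b) _ hc (by simp), h, leviCivita_const_smul c (A.mdiffAt_map (hm b)),
      leviCivita_const_smul c (hm b), map_smul, ← smul_sub, real_inner_smul_right]
    rfl
  · have hz : d% (fun q : M ↦ (inner ℝ (extend E a q : TangentSpace 𝓘(ℝ, E) q)
        (A.map (extend E b) q) : ℝ) + inner ℝ (A.map (extend E a) q) (extend E b q)) p x = 0 := by
      have : (fun q : M ↦ (inner ℝ (extend E a q : TangentSpace 𝓘(ℝ, E) q)
          (A.map (extend E b) q) : ℝ) + inner ℝ (A.map (extend E a) q) (extend E b q)) =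
          fun _ ↦ 0 := by
        ext q
        rw [(A.isOrthogonalComplex q).inner_left]
        simp
      rw [this, mvfderiv_const]; rfl
    rw [mvfderiv_fun_add (mdiffAt_inner (hm a) (A.mdiffAt_map (hm b)))
      (mdiffAt_inner (A.mdiffAt_map (hm a)) (hm b)), add_apply,
      mvfderiv_inner_apply (hm a) (A.mdiffAt_map (hm b)),
      mvfderiv_inner_apply (A.mdiffAt_map (hm a)) (hm b), A.leviCivita_map (hm a),
      A.leviCivita_map (hm b)] at hz
    simp only [map, extend_apply_self, inner_add_left, inner_add_right,
      (A.isOrthogonalComplex p).inner_left] at hz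
    rw [real_inner_comm (A.nablaJ p x a) b]
    linarith
  · have h1 : A.nablaJ p x (A.J p b) = - A.J p (A.nablaJ p x b) := by
      rw [heq x (A.J p b) (A.map (extend E b)) (A.mdiffAt_map (hm b)) (by simp [map])]
      have h : A.map (A.map (extend E b)) = - extend E b := by
        exact funext fun q ↦ A.J_J q _
      rw [h, leviCivita_neg (hm b), A.leviCivita_map (hm b), map_add, A.J_J, extend_apply_self]
      abel
    rw [h1, inner_neg_right, (A.isOrthogonalComplex p).inner_left]

variable {A} in
theorem curvatureField_eq_formCurv {ν μ : ℝ} {q : M}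
    (h : ∀ x y z u : TangentSpace 𝓘(ℝ, E) q,
      curvatureTensor q x y z u = inner ℝ (formCurv (A.J q) ν μ x y z) u)
    (hX : CMDiffAt ∞ (T% X) q) (hY : CMDiffAt ∞ (T% Y) q) (hZ : CMDiffAt ∞ (T% Z) q) :
    curvatureField X Y Z q = formCurv (A.J q) ν μ (X q) (Y q) (Z q) :=
  ext_inner_right ℝ fun u ↦ by rw [inner_curvatureField hX hY hZ, h]

/-- The vector field `ν π₁(Y, Z)W + μ π₂(Y, Z)W`. -/
noncomputable abbrev formField (ν μ : M → ℝ) (Y Z W : Π x : M, TangentSpace 𝓘(ℝ, E) x) :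
    Π x : M, TangentSpace 𝓘(ℝ, E) x :=
  fun q ↦ formCurv (A.J q) (ν q) (μ q) (Y q) (Z q) (W q)

/-- The Leibniz rule: `bianchiTerm` collects the derivatives of `ν`, `μ` and `J`, while the other
terms differentiate the vector fields. -/
theorem inner_leviCivita_formField {ν μ : M → ℝ} (hν : MDiffAt ν p) (hμ : MDiffAt μ p)
    (hY : MDiffAt (T% Y) p) (hZ : MDiffAt (T% Z) p) (hW : MDiffAt (T% W) p)
    (x u : TangentSpace 𝓘(ℝ, E) p) :
    MDiffAt (T% (A.formField ν μ Y Z W)) p ∧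
    (inner ℝ (leviCivita E M (A.formField ν μ Y Z W) p x) u : ℝ) =
      bianchiTerm (A.J p) (d% ν p) (d% μ p) (μ p) (fun x a b ↦ (inner ℝ a (A.nablaJ p x b) : ℝ))
        x (Y p) (Z p) (W p) u
      + inner ℝ (formCurv (A.J p) (ν p) (μ p) (leviCivita E M Y p x) (Z p) (W p)) u
      + inner ℝ (formCurv (A.J p) (ν p) (μ p) (Y p) (leviCivita E M Z p x) (W p)) u
      + inner ℝ (formCurv (A.J p) (ν p) (μ p) (Y p) (Z p) (leviCivita E M W p x)) u := by
  have hJY := A.mdiffAt_map hY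
  have hJZ := A.mdiffAt_map hZ
  have hJW := A.mdiffAt_map hW
  have t1 := mdiffAt_inner_smul hZ hW hY
  have t2 := mdiffAt_inner_smul hY hW hZ
  have t3 := mdiffAt_inner_smul hY hJW hJZ
  have t4 := mdiffAt_inner_smul hZ hJW hJY
  have t5 := mdiffAt_inner_smul hY hJZ hJW
  have t12 := mdifferentiableAt_sub_section t1 t2
  have t34 := mdifferentiableAt_sub_section t3 t4
  have t55 := mdifferentiableAt_add_section t5 t5
  have t35 := mdifferentiableAt_add_section t34 t55
  have e : A.formField ν μ Y Z W =
      ν • ((fun q ↦ (inner ℝ (Z q) (W q) : ℝ)) • Y - (fun q ↦ (inner ℝ (Y q) (W q) : ℝ)) • Z)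
      + μ • ((fun q ↦ (inner ℝ (Y q) (A.map W q) : ℝ)) • A.map Z
        - (fun q ↦ (inner ℝ (Z q) (A.map W q) : ℝ)) • A.map Y
        + ((fun q ↦ (inner ℝ (Y q) (A.map Z q) : ℝ)) • A.map W
          + (fun q ↦ (inner ℝ (Y q) (A.map Z q) : ℝ)) • A.map W)) := by
    ext1 q
    simp only [formField, formCurv, unitCurv, complexCurv, Pi.add_apply, Pi.sub_apply,
      Pi.smul_apply', map]
    module
  have hmd := mdifferentiableAt_add_section (hν.smul_section t12) (hμ.smul_section t35)
  rw [e]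
  refine ⟨hmd, ?_⟩
  have hJ := A.isOrthogonalComplex p
  have hα := A.isNablaComplex p
  have hs : ∀ a : TangentSpace 𝓘(ℝ, E) p, (inner ℝ (A.nablaJ p x a) u : ℝ) =
      - inner ℝ a (A.nablaJ p x u) := fun a ↦ by
    rw [real_inner_comm]; exact hα.swap x u a
  rw [leviCivita_add (hν.smul_section t12) (hμ.smul_section t35), leviCivita_smul hν t12,
    leviCivita_smul hμ t35, leviCivita_sub t1 t2, leviCivita_add t34 t55, leviCivita_sub t3 t4,
    leviCivita_add t5 t5, leviCivita_inner_smul hZ hW hY, leviCivita_inner_smul hY hW hZ,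
    leviCivita_inner_smul hY hJW hJZ, leviCivita_inner_smul hZ hJW hJY,
    leviCivita_inner_smul hY hJZ hJW, A.leviCivita_map hY, A.leviCivita_map hZ,
    A.leviCivita_map hW]
  simp only [inner_formCurv hJ, bianchiTerm, map, Pi.add_apply, Pi.sub_apply, Pi.smul_apply',
    inner_add_left, inner_sub_left, inner_add_right, real_inner_smul_left, hJ.inner_left, hs]
  ring

/-- The second Bianchi identity for a generalized complex space form. -/
theorem bianchiIdentity {ν μ : M → ℝ} (hν : MDiffAt ν p) (hμ : MDiffAt μ p)
    (h : ∀ (q : M) (x y z u : TangentSpace 𝓘(ℝ, E) q),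
      curvatureTensor q x y z u = inner ℝ (formCurv (A.J q) (ν q) (μ q) x y z) u) :
    BianchiIdentity (A.J p) (d% ν p) (d% μ p) (μ p)
      (fun x a b ↦ (inner ℝ a (A.nablaJ p x b) : ℝ)) := by
  intro x y z w u
  have hs := fun v : TangentSpace 𝓘(ℝ, E) p ↦ contMDiffAt_extend_smooth v
  have hB := second_bianchi (hs x) (hs y) (hs z) (hs w) (eventually_mlieBracket_extend x y)
    (eventually_mlieBracket_extend y z) (eventually_mlieBracket_extend z x)
  have hterm : ∀ x y z : TangentSpace 𝓘(ℝ, E) p,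
      (inner ℝ (leviCivita E M (curvatureField (extend E y) (extend E z) (extend E w)) p
          ((extend E x : Π x : M, TangentSpace 𝓘(ℝ, E) x) p)
        - curvatureField (extend E y) (extend E z) (nabla (extend E x) (extend E w)) p) u : ℝ) =
      bianchiTerm (A.J p) (d% ν p) (d% μ p) (μ p) (fun x a b ↦ (inner ℝ a (A.nablaJ p x b) : ℝ))
        x y z w u
      + inner ℝ (formCurv (A.J p) (ν p) (μ p) (leviCivita E M (extend E y) p x) z w) u
      + inner ℝ (formCurv (A.J p) (ν p) (μ p) y (leviCivita E M (extend E z) p x) w) u := by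
    intro x y z
    obtain ⟨h1, h2⟩ := A.inner_leviCivita_formField hν hμ (mdiffAt_extend y) (mdiffAt_extend z)
      (mdiffAt_extend w) x u
    have he : (curvatureField (extend E y) (extend E z) (extend E w) :
        Π x : M, TangentSpace 𝓘(ℝ, E) x) =ᶠ[𝓝 p]
        A.formField ν μ (extend E y) (extend E z) (extend E w) := by
      filter_upwards [eventually_contMDiffAt_extend y, eventually_contMDiffAt_extend z,
        eventually_contMDiffAt_extend w] with q h1 h2 h3
      exact curvatureField_eq_formCurv (h q) h1 h2 h3
    have h3 : MDiffAt (T% (curvatureField (extend E y) (extend E z) (extend E w) :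
        Π x : M, TangentSpace 𝓘(ℝ, E) x)) p :=
      h1.congr_of_eventuallyEq (he.mono fun q hq ↦ by simp [hq])
    rw [inner_sub_left, leviCivita_congr h3 h1 he, curvatureField_eq_formCurv (h p) (hs y) (hs z)
      (contMDiffAt_leviCivita (hs x) (hs w))]
    simp only [extend_apply_self] at h2 ⊢
    rw [h2]
    ring
  have hc : ∀ x y : TangentSpace 𝓘(ℝ, E) p,
      leviCivita E M (extend E y) p x = leviCivita E M (extend E x) p y := by
    intro x y
    have := nabla_sub_nabla (mdiffAt_extend x) (mdiffAt_extend y)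
    rw [(eventually_mlieBracket_extend x y).self_of_nhds, sub_eq_zero] at this
    simpa [nabla] using this
  have hu := congrArg (fun v ↦ (inner ℝ v u : ℝ)) hB
  simp only [inner_add_left, hterm, inner_zero_left] at hu
  -- The terms in which `Y` or `Z` was differentiated cancel cyclically: `∇_x Y = ∇_y X` for
  -- commuting fields, and `R` is skew in its first two arguments.
  have hR := isCurvatureLike_formCurv (A.isOrthogonalComplex p) (ν p) (μ p)
  have r1 := hR.swap_left (leviCivita E M (extend E y) p x) z w u
  have r2 := hR.swap_left (leviCivita E M (extend E z) p y) x w u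
  have r3 := hR.swap_left (leviCivita E M (extend E x) p z) y w u
  rw [hc y x, hc z y, hc x z] at hu
  linarith

end AlmostHermitianStructure

end SecondBianchi

/-! ### Functions with vanishing differential. -/

section LocallyConstant

variable {E : Type*} [NormedAddCommGroup E] [NormedSpace ℝ E]
  {M : Type*} [TopologicalSpace M] [ChartedSpace E M] [IsManifold 𝓘(ℝ, E) ∞ M]

/-- A function with vanishing differential on a connected manifold is constant. -/
theorem eq_of_mvfderiv_eq_zero [PreconnectedSpace M] {f : M → ℝ}
    (hf : ∀ p, MDiffAt f p) (h : ∀ p, d% f p = 0) (p q : M) : f p = f q := by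
  refine IsLocallyConstant.iff_is_const.1 ((IsLocallyConstant.iff_eventually_eq f).2 fun p ↦ ?_) p q
  have : IsManifold 𝓘(ℝ, E) 1 M := IsManifold.of_le (n := ∞) (by simp)
  set e := chartAt E p with he
  have hd : ∀ y ∈ e.target, HasFDerivAt (f ∘ e.symm) (0 : E →L[ℝ] ℝ) y := by
    intro y hy
    have h1 : MDiffAt e.symm y := mdifferentiableAt_atlas_symm (chart_mem_atlas E p) hy
    have h2 := (hf (e.symm y)).hasMFDerivAt.comp y h1.hasMFDerivAt
    have h3 : mfderiv 𝓘(ℝ, E) 𝓘(ℝ, ℝ) f (e.symm y) = 0 := h (e.symm y)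
    rw [h3, ContinuousLinearMap.zero_comp] at h2
    exact h2.hasFDerivAt
  -- In the chart, level sets of a function with zero derivative are open, so `f` is locally
  -- constant.
  have ho := e.open_target.isOpen_inter_preimage_of_fderiv_eq_zero (f := f ∘ e.symm)
    (fun y hy ↦ (hd y hy).differentiableAt.differentiableWithinAt) (fun y hy ↦ (hd y hy).fderiv)
    {f p}
  filter_upwards [(e.isOpen_inter_preimage ho).mem_nhds
    ⟨mem_chart_source E p, e.map_source (mem_chart_source E p), by
      simp [e.left_inv (mem_chart_source E p)]⟩] with x hx
  simpa [e.left_inv hx.1] using hx.2.2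

end LocallyConstant

/-! ### Regularity of the coefficients and curvature of planes by angle. -/

section SpaceForm

variable {E : Type*} [NormedAddCommGroup E] [NormedSpace ℝ E] [FiniteDimensional ℝ E]
  {M : Type*} [TopologicalSpace M] [ChartedSpace E M] [IsManifold 𝓘(ℝ, E) ∞ M]
  [RiemannianBundle (fun x : M ↦ TangentSpace 𝓘(ℝ, E) x)]
  [IsContMDiffRiemannianBundle 𝓘(ℝ, E) ∞ E (fun x : M ↦ TangentSpace 𝓘(ℝ, E) x)]

variable {X Y Z : Π x : M, TangentSpace 𝓘(ℝ, E) x} {p : M}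

theorem contMDiffAt_curvatureField (hX : CMDiffAt ∞ (T% X) p) (hY : CMDiffAt ∞ (T% Y) p)
    (hZ : CMDiffAt ∞ (T% Z) p) : CMDiffAt ∞ (T% (curvatureField X Y Z)) p :=
  ((contMDiffAt_leviCivita hX (contMDiffAt_leviCivita hY hZ)).sub_section
    (contMDiffAt_leviCivita hY (contMDiffAt_leviCivita hX hZ))).sub_section
      (contMDiffAt_leviCivita (contMDiffAt_mlieBracket hX hY) hZ)

namespace AlmostHermitianStructure

variable (A : AlmostHermitianStructure E M)

/-- The coefficients of the curvature tensor of a generalized complex space form are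
differentiable. -/
theorem mdiffAt_coefficients (hE : 6 ≤ Module.finrank ℝ E) {ν μ : M → ℝ}
    (h : ∀ (q : M) (x y z u : TangentSpace 𝓘(ℝ, E) q),
      curvatureTensor q x y z u = inner ℝ (formCurv (A.J q) (ν q) (μ q) x y z) u) (p : M) :
    MDiffAt ν p ∧ MDiffAt μ p := by
  obtain ⟨x, hx, -⟩ := (A.isOrthogonalComplex p).exists_unit_orthogonal hE 0 0
  obtain ⟨y, hy, hxy, hxJy, -⟩ := (A.isOrthogonalComplex p).exists_unit_orthogonal hE x 0
  set X : Π x : M, TangentSpace 𝓘(ℝ, E) x := extend E x with hX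
  set Y : Π x : M, TangentSpace 𝓘(ℝ, E) x := extend E y with hY
  have sX : CMDiffAt ∞ (T% X) p := contMDiffAt_extend_smooth x
  have sY : CMDiffAt ∞ (T% Y) p := contMDiffAt_extend_smooth y
  have sJX := A.contMDiffAt_map sX
  have sJY := A.contMDiffAt_map sY
  set a : M → ℝ := fun q ↦ inner ℝ (X q) (X q) with ha
  set D : M → ℝ := fun q ↦ inner ℝ (X q) (X q) * inner ℝ (Y q) (Y q) - inner ℝ (X q) (Y q) ^ 2
    with hD
  set w : M → ℝ := fun q ↦ inner ℝ (X q) (A.map Y q) with hw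
  set k : M → ℝ := fun q ↦ inner ℝ (curvatureField X (A.map X) (A.map X) q) (X q) with hk
  set l : M → ℝ := fun q ↦ inner ℝ (curvatureField X Y Y q) (X q) with hl
  have sa : CMDiffAt ∞ a p := contMDiffAt_inner sX sX
  have sD : CMDiffAt ∞ D p := ((contMDiffAt_inner sX sX).mul (contMDiffAt_inner sY sY)).sub
    ((contMDiffAt_inner sX sY).pow 2)
  have sw : CMDiffAt ∞ w p := contMDiffAt_inner sX sJY
  have sk : CMDiffAt ∞ k p := contMDiffAt_inner (contMDiffAt_curvatureField sX sJX sJX) sX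
  have sl : CMDiffAt ∞ l p := contMDiffAt_inner (contMDiffAt_curvatureField sX sY sY) sX
  -- `ν` and `μ` were chosen pointwise with no regularity. The curvatures `k` and `l` form a linear
  -- system in `ν` and `3 μ` with this determinant, equal to `-1` at `p`; away from `p` the extended
  -- fields need not be orthonormal.
  have sd : CMDiffAt ∞ (fun q ↦ a q ^ 2 * (w q ^ 2 - D q)) p :=
    (sa.pow 2).mul ((sw.pow 2).sub sD)
  have hp : a p ^ 2 * (w p ^ 2 - D p) ≠ 0 := by
    simp only [ha, hw, hD, hX, hY, map, extend_apply_self, hx, hy, hxy, hxJy]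
    norm_num
  have hev : ∀ᶠ q in 𝓝 p, a q ^ 2 * (w q ^ 2 - D q) ≠ 0 ∧
      k q = (ν q + 3 * μ q) * a q ^ 2 ∧ l q = ν q * D q + 3 * μ q * w q ^ 2 := by
    filter_upwards [sd.continuousAt.eventually_ne hp, eventually_contMDiffAt_extend x,
      eventually_contMDiffAt_extend y] with q hq hXq hYq
    have hJ := A.isOrthogonalComplex q
    refine ⟨hq, ?_, ?_⟩
    · rw [hk, ha]
      simp only
      rw [inner_curvatureField hXq (A.contMDiffAt_map hXq) (A.contMDiffAt_map hXq), h,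
        formCurv_sectional hJ]
      simp only [map]
      rw [hJ.inner_map, hJ.inner_self, hJ.sq, inner_neg_right]
      ring
    · rw [hl, hD, hw]
      simp only
      rw [inner_curvatureField hXq hYq hYq, h, formCurv_sectional hJ]
  constructor
  · have s : CMDiffAt ∞ (fun q ↦ (k q * w q ^ 2 - l q * a q ^ 2) / (a q ^ 2 * (w q ^ 2 - D q))) p :=
      ((sk.mul (sw.pow 2)).sub (sl.mul (sa.pow 2))).div₀ sd hp
    refine (s.mdifferentiableAt (by simp)).congr_of_eventuallyEq ?_
    filter_upwards [hev] with q ⟨hq, e1, e2⟩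
    rw [eq_div_iff hq, e1, e2]
    ring
  · have s : CMDiffAt ∞ (fun q ↦ (l q * a q ^ 2 - k q * D q)
        / ((3 : ℝ) * (a q ^ 2 * (w q ^ 2 - D q)))) p :=
      ((sl.mul (sa.pow 2)).sub (sk.mul sD)).div₀ (contMDiffAt_const.mul sd)
        (mul_ne_zero three_ne_zero hp)
    refine (s.mdifferentiableAt (by simp)).congr_of_eventuallyEq ?_
    filter_upwards [hev] with q ⟨hq, e1, e2⟩
    rw [eq_div_iff (mul_ne_zero three_ne_zero hq), e1, e2]
    ring

theorem sectionalCurvature_eq {ν μ : ℝ} {p : M} {x y : TangentSpace 𝓘(ℝ, E) p}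
    (h : ∀ x y z u : TangentSpace 𝓘(ℝ, E) p,
      curvatureTensor p x y z u = inner ℝ (formCurv (A.J p) ν μ x y z) u)
    (hxy : IsOrthonormalPair p x y) :
    sectionalCurvature p x y = ν + 3 * μ * inner ℝ x (A.J p y) ^ 2 := by
  obtain ⟨h1, h2, h3⟩ := hxy
  rw [sectionalCurvature, h, formCurv_sectional (A.isOrthogonalComplex p), h1, h2, h3]
  ring

/-- Cauchy–Schwarz places the inner product in the range where `arccos` inverts `cos`. -/
theorem abs_inner_eq_cos_planeAngle {p : M} {x y : TangentSpace 𝓘(ℝ, E) p}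
    (hxy : IsOrthonormalPair p x y) :
    |(inner ℝ x (A.J p y) : ℝ)| = Real.cos (A.planeAngle p x y) := by
  obtain ⟨h1, h2, -⟩ := hxy
  have h := abs_real_inner_le_norm x (A.J p y)
  have hx : ‖x‖ = 1 := by
    rw [real_inner_self_eq_norm_sq] at h1
    exact (pow_eq_one_iff_of_nonneg (norm_nonneg x) two_ne_zero).1 h1
  have hy : ‖A.J p y‖ = 1 := by
    rw [← A.inner_J_J, real_inner_self_eq_norm_sq] at h2
    exact (pow_eq_one_iff_of_nonneg (norm_nonneg _) two_ne_zero).1 h2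
  rw [hx, hy, mul_one] at h
  rw [planeAngle, Real.cos_arccos (by linarith [abs_nonneg (inner ℝ x (A.J p y) : ℝ)]) h]

/-- Pointwise constant `θ`-holomorphic sectional curvature makes the manifold a generalized
complex space form. -/
theorem HasPointwiseConstantHolomorphicCurvature.exists_formCurv
    {A : AlmostHermitianStructure E M} (hE : 6 ≤ Module.finrank ℝ E) {θ : ℝ}
    (hθ : θ ∈ Set.Ioo 0 (Real.pi / 2)) (hA : A.HasPointwiseConstantHolomorphicCurvature θ) :
    ∃ ν μ : M → ℝ, ∀ (q : M) (x y z u : TangentSpace 𝓘(ℝ, E) q),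
      curvatureTensor q x y z u = inner ℝ (formCurv (A.J q) (ν q) (μ q) x y z) u := by
  obtain ⟨c, hc⟩ := hA
  have hC : 0 < Real.cos θ := Real.cos_pos_of_mem_Ioo ⟨by linarith [hθ.1, hθ.2], hθ.2⟩
  have hS : 0 < Real.sin θ := Real.sin_pos_of_mem_Ioo ⟨hθ.1, by linarith [hθ.1, hθ.2]⟩
  have key : ∀ q : M, ∃ ν μ : ℝ, ∀ x y z u : TangentSpace 𝓘(ℝ, E) q,
      curvatureTensor q x y z u = inner ℝ (formCurv (A.J q) ν μ x y z) u := fun q ↦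
    AlmostHermitian.exists_formCurv (A.isOrthogonalComplex q) hE (isCurvatureLike_curvatureTensor q)
      hC hS (Real.cos_sq_add_sin_sq θ) fun x y hx hy hxy h ↦ hc q x y ⟨hx, hy, hxy⟩ <| by
        rw [planeAngle, h, Real.arccos_cos hθ.1.le (by linarith [hθ.1, hθ.2])]
  choose ν μ h using key
  exact ⟨ν, μ, h⟩

end AlmostHermitianStructure

end SpaceForm

end AlmostHermitian

/-! ### The dichotomy. -/

theorem mainTheorem1 {E : Type*} [NormedAddCommGroup E] [NormedSpace ℝ E] [FiniteDimensional ℝ E]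
    {M : Type*} [TopologicalSpace M] [ChartedSpace E M] [IsManifold 𝓘(ℝ, E) ∞ M]
    [ConnectedSpace M]
    [RiemannianBundle (fun x : M ↦ TangentSpace 𝓘(ℝ, E) x)]
    [IsContMDiffRiemannianBundle 𝓘(ℝ, E) ∞ E (fun x : M ↦ TangentSpace 𝓘(ℝ, E) x)]
    (A : AlmostHermitian.AlmostHermitianStructure E M)
    (m : ℕ) (hdim : Module.finrank ℝ E = 2 * m) (hm : 6 ≤ 2 * m)
    (θ : ℝ) (hθ : θ ∈ Set.Ioo 0 (Real.pi / 2))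
    (hcurv : A.HasPointwiseConstantHolomorphicCurvature θ) :
    AlmostHermitian.HasConstantSectionalCurvature E M ∨
      (A.IsKahler ∧
        ∀ φ ∈ Set.Ioo 0 (Real.pi / 2), A.HasConstantHolomorphicCurvature φ) := by
  have hE : 6 ≤ Module.finrank ℝ E := hdim ▸ hm
  obtain ⟨ν, μ, h⟩ := hcurv.exists_formCurv hE hθ
  have hd := A.mdiffAt_coefficients hE h
  have hJ := A.isOrthogonalComplex
  have hB := fun p ↦ A.bianchiIdentity (hd p).1 (hd p).2 h
  have hdμ : ∀ p, d% μ p = 0 := fun p ↦ ContinuousLinearMap.ext fun x ↦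
    (A.isNablaComplex p).differential_eq_zero (hJ p) hE (hB p) x
  have hdν : ∀ p, d% ν p = 0 := fun p ↦ ContinuousLinearMap.ext fun x ↦
    (hB p).differential_eq_zero (hJ p) hE x
  obtain ⟨p₀⟩ := (inferInstance : Nonempty M)
  have hν := fun p ↦ AlmostHermitian.eq_of_mvfderiv_eq_zero (fun q ↦ (hd q).1) hdν p p₀
  have hμ := fun p ↦ AlmostHermitian.eq_of_mvfderiv_eq_zero (fun q ↦ (hd q).2) hdμ p p₀
  -- Since `μ` is globally constant, its value at one point decides the alternative for all of `M`.
  by_cases h0 : μ p₀ = 0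
  · refine Or.inl ⟨ν p₀, fun p x y hxy ↦ ?_⟩
    rw [A.sectionalCurvature_eq (h p) hxy, hν, hμ, h0]
    ring
  · refine Or.inr ⟨fun p Y hY x ↦ ?_, fun φ _ ↦
      ⟨ν p₀ + 3 * μ p₀ * Real.cos φ ^ 2, fun p x y hxy hφ ↦ ?_⟩⟩
    · have hn : A.nablaJ p x (Y p) = 0 := ext_inner_left ℝ fun a ↦ by
        have := (A.isNablaComplex p).mul_eq_zero (hJ p) hE (hB p) x a (Y p)
        rw [hμ p] at this
        rw [inner_zero_right]
        exact (mul_eq_zero.1 this).resolve_left h0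
      have := A.leviCivita_map hY x
      rwa [hn, zero_add] at this
    · rw [A.sectionalCurvature_eq (h p) hxy, ← hφ, ← A.abs_inner_eq_cos_planeAngle hxy, sq_abs, hν,
        hμ]
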